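/- **Theorem.** For every $\kappa>0$ there are constants $C,c,c_0,c_1>0$, depending only on $\kappa$, such that the following holds for all integers $1\le d\le n$ (in particular whenever $d=o(n)$, for all large $n$) and all $k\ge 1$ dividing $n$. Let $x_1,\dots,x_n\in\mathbb R^d$ be i.i.d. centered random vectors with positive definite covariance matrix $\Sigma$ that are $\kappa$-subgaussian, i.e. $\mathbb E\exp(\langle x_i,u\rangle^2/\kappa^2)\le 2$ for every unit vector $u$; let $X\in\mathbb R^{n\times d}$ be the matrix with rows $x_i$. Let $y_i=\langle x_i,\theta^*\rangle+\varepsilon_i$ with $\theta^*\in\mathbb R^d$ fixed, where the noise vector $\varepsilon$ is independent of $X$ and satisfies $\mathbb E\,\varepsilon=0$, $\mathbb E\,\varepsilon\varepsilon^{\top}=\sigma^2 I$. Let $B_1,\dots,B_m$ be a partition of $\{1,\dots,n\}$ into $m=n/k$ bags of size $k$, deterministic or random, chosen independently of the data $(X,y)$ (for example random bagging). Let $\bar y_\ell=\frac1k\sum_{i\in B_\ell}y_i$, and let $\hat\theta$ be a (measurable) minimizer of the event-level loss $$\theta\ \mapsto\ \frac1n\sum_{\ell=1}^m\sum_{i\in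 B_\ell}\bigl(\bar y_\ell-\langle x_i,\theta\rangle\bigr)^2 .$$ Then, with probability at least $1-2e^{-c_1d}-2d^{-c}$, $$\mathbb E\bigl[\|\hat\theta-\theta^*\|_2^2\,\big|\,X\bigr]\ \ge\ \Bigl(1-\frac1k-C\,\frac{d\sqrt{\log d}}{\sigma_{\min}(\Sigma)\sqrt n}\Bigr)_+^2\|\theta^*\|_2^2\;+\;\frac{\sigma^2}{kn}\cdot\frac{\operatorname{tr}(\Sigma)-\sqrt{d\log d}}{\bigl(\|\Sigma\|_{\mathrm{op}}+c_0\sqrt{d/n}\bigr)^2},$$ where $(a)_+=\max(a,0)$ and $\sigma_{\min}(\Sigma)$ is the smallest singular value of $\Sigma$. The conditional expectation, taken in $[0,\infty]$, averages over the noise and over the random choice of the bags. -/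

import Mathlib

open MeasureTheory ProbabilityTheory

namespace AggregateLearning

variable {Ω : Type*} [MeasurableSpace Ω]

/-- A random vector `Z` in `ℝᵈ` is `κ`-subgaussian: every one-dimensional projection `ξ = ⟨Z, u⟩`,
with `u` a unit vector, has `ψ₂`-norm at most `κ`, that is `𝔼 exp(ξ² / κ²) ≤ 2`. -/
def IsSubgaussian {d : ℕ} (κ : ℝ) (Z : Ω → EuclideanSpace ℝ (Fin d)) (P : Measure Ω) : Prop :=
  ∀ u : EuclideanSpace ℝ (Fin d), ‖u‖ = 1 →
    ∫⁻ ω, ENNReal.ofReal (Real.exp ((inner ℝ (Z ω) u) ^ 2 / κ ^ 2)) ∂P ≤ 2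

/-- The rows `x₁, …, xₙ` are i.i.d. centered `κ`-subgaussian random vectors in `ℝᵈ` with
covariance matrix `A`. -/
structure IsSubgaussianDesign {n d : ℕ} (κ : ℝ) (A : Matrix (Fin d) (Fin d) ℝ)
    (x : Fin n → Ω → EuclideanSpace ℝ (Fin d)) (P : Measure Ω) : Prop where
  measurable : ∀ i, Measurable (x i)
  indep : iIndepFun x P
  identDistrib : ∀ i j, IdentDistrib (x i) (x j) P P
  subgaussian : ∀ i, IsSubgaussian κ (x i) P
  centered : ∀ i a, ∫ ω, x i ω a ∂P = 0
  covariance : ∀ i a b, ∫ ω, x i ω a * x i ω b ∂P = A a b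

/-- The noise `ε = (ε₁, …, εₙ)` is square integrable, with `𝔼 ε = 0` and `𝔼 εεᵀ = σ² I`. -/
structure IsWhiteNoise {n : ℕ} (σ : ℝ) (ε : Fin n → Ω → ℝ) (P : Measure Ω) : Prop where
  measurable : ∀ i, Measurable (ε i)
  memLp : ∀ i, MemLp (ε i) 2 P
  centered : ∀ i, ∫ ω, ε i ω ∂P = 0
  covariance : ∀ i j, ∫ ω, ε i ω * ε j ω ∂P = if i = j then σ ^ 2 else 0

/-- The bag with label `ℓ`, when sample `i` is put into the bag `b i`. -/
def bag {n m : ℕ} (b : Fin n → Fin m) (l : Fin m) : Finset (Fin n) :=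
  Finset.univ.filter fun i => b i = l

/-- The mean response in the bag with label `ℓ`. -/
noncomputable def bagMean {n m : ℕ} (b : Fin n → Fin m) (y : Fin n → ℝ) (l : Fin m) : ℝ :=
  (∑ i ∈ bag b l, y i) / (bag b l).card

/-- The event-level squared loss of the linear model `θ`: each individual prediction `⟨xᵢ, θ⟩` is
fitted to the mean response of the bag that contains the sample `i`. -/
noncomputable def eventLoss {n m d : ℕ} (b : Fin n → Fin m)
    (x : Fin n → EuclideanSpace ℝ (Fin d)) (y : Fin n → ℝ)
    (θ : EuclideanSpace ℝ (Fin d)) : ℝ :=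
  (1 / (n : ℝ)) * ∑ l, ∑ i ∈ bag b l, (bagMean b y l - inner ℝ (x i) θ) ^ 2

/-- The responses `yᵢ = ⟨xᵢ, θ⋆⟩ + εᵢ` of the linear model. -/
noncomputable def response {n d : ℕ} (θs : EuclideanSpace ℝ (Fin d))
    (x : Fin n → Ω → EuclideanSpace ℝ (Fin d)) (ε : Fin n → Ω → ℝ) (ω : Ω) (i : Fin n) : ℝ :=
  inner ℝ (x i ω) θs + ε i ω

/-- The design matrix, as the random family of its rows. -/
def design {n d : ℕ} (x : Fin n → Ω → EuclideanSpace ℝ (Fin d)) (ω : Ω) :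
    Fin n → EuclideanSpace ℝ (Fin d) :=
  fun i => x i ω

/-- The risk `𝔼[‖θ̂ - θ⋆‖² | X]`, as a `[0, ∞]`-valued conditional expectation given the
`σ`-algebra generated by the design matrix. -/
noncomputable def condRisk {n d : ℕ} (P : Measure Ω) (θh : Ω → EuclideanSpace ℝ (Fin d))
    (θs : EuclideanSpace ℝ (Fin d)) (x : Fin n → Ω → EuclideanSpace ℝ (Fin d)) :
    Ω → ENNReal :=
  condLExp (MeasurableSpace.comap (design x) inferInstance) P fun ω =>
    ENNReal.ofReal (‖θh ω - θs‖ ^ 2)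

/-- The operator norm of a square matrix with respect to the Euclidean norm. -/
noncomputable def opNorm {d : ℕ} (A : Matrix (Fin d) (Fin d) ℝ) : ℝ :=
  ‖Matrix.toEuclideanCLM (𝕜 := ℝ) A‖

/-- The smallest of the `d` singular values of a `d × d` matrix. -/
noncomputable def sigmaMin {d : ℕ} (A : Matrix (Fin d) (Fin d) ℝ) : ℝ :=
  (Matrix.toEuclideanLin A).singularValues (d - 1)

end AggregateLearning

/-!
The minimizer `θ̂` of the event-level loss solves normal equations: with `G = ∑ᵢ xᵢ xᵢᵀ`
(`gramOp`), with `O` the sum of the `xᵢ xⱼᵀ` over ordered pairs of distinct samples in a common bag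
(`bagOp`), and with `x̄ⱼ` the mean of the bag of `j` (`bagAvg`),
`G (θ̂ - θ⋆) = (1/k) O θ⋆ - (1 - 1/k) G θ⋆ + ∑ⱼ εⱼ x̄ⱼ` (`gramOp_sub_eq`).
Hence the error has a bias close to `-(1 - 1/k) θ⋆`, the shrinkage caused by fitting individual
predictions to bag means, and a variance part governed by `∑ⱼ ‖x̄ⱼ‖²`.

*Conditional risk.* Let `R` be a linear map, depending on the design, with `‖R G v‖ ≤ ‖v‖`. Then
`‖θ̂ - θ⋆‖` is at least the norm of `R` applied to the right-hand side. Given the design, the noise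
integrates out by orthogonality (`lintegral_norm_add_sum_smul_sq`), and what remains is an average
over the bags (`ae_le_condRisk`). Jensen's inequality replaces the bias by its mean over the bags,
so that only the averaged operator `meanBagOp` matters, and `∑ⱼ ‖x̄ⱼ‖²` is `1/k` times
`∑ᵢ ‖xᵢ‖²` plus the trace of `O` (`sum_norm_bagAvg_sq`, `le_meanRisk`). If the positive part in the
claimed bound is not zero, then `G` is invertible on the good event and `R = G⁻¹` is used. Otherwise
`G` may be singular, but the bias may be dropped, and `R` is a multiple of the identity.

*Concentration.* It remains to show that with the stated probability `G / n` is close to `Σ`,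
the average of `O` is small compared with `n k`, and `∑ᵢ ‖xᵢ‖²` plus the trace of the average of `O`
is at least `n (tr Σ - √(d log d))` (`IsSubgaussianDesign.le_measure_goodDesigns`). Averages over
the bags are moved out of the exponential moment by Jensen's inequality, so it suffices to treat a
fixed assignment of bags. There `bagChaos`, an off-diagonal quadratic form, is decoupled; it is then
linear in one block of samples, and the squared norm that results from integrating this block is
linearised by a Gaussian vector. This gives a moment bound of Hanson–Wright type
(`lintegral_eexp_bagChaos_le`). A `1/2`-net of the unit sphere with at most `5 ^ d` points turns
the bounds for quadratic forms into bounds for operator norms of the order `√(d/n)`. The lower tail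
of `∑ᵢ ‖xᵢ‖²` follows from `exp (-y) ≤ 1 - y + y²/2` for `y ≥ 0`.
-/

namespace AggregateLearning

variable {Ω : Type*} [MeasurableSpace Ω]

/-! ### The exponential with values in `[0, ∞]` -/

/-- The real exponential, regarded as a function with values in `[0, ∞]`, so that exponential
moments are Lebesgue integrals and need no integrability side conditions. -/
noncomputable def eexp (r : ℝ) : ENNReal := ENNReal.ofReal (Real.exp r)

lemma eexp_add (r s : ℝ) : eexp (r + s) = eexp r * eexp s := by
  rw [eexp, Real.exp_add, ENNReal.ofReal_mul (Real.exp_nonneg r), eexp, eexp]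

lemma eexp_zero : eexp 0 = 1 := by simp [eexp]

lemma eexp_sum {ι : Type*} (s : Finset ι) (f : ι → ℝ) :
    eexp (∑ i ∈ s, f i) = ∏ i ∈ s, eexp (f i) := by
  classical
  induction s using Finset.induction_on with
  | empty => simp [eexp_zero]
  | insert i s hi ih => rw [Finset.sum_insert hi, Finset.prod_insert hi, eexp_add, ih]

lemma eexp_mono {r s : ℝ} (h : r ≤ s) : eexp r ≤ eexp s :=
  ENNReal.ofReal_le_ofReal (Real.exp_le_exp.2 h)

lemma measurable_eexp : Measurable eexp :=
  ENNReal.measurable_ofReal.comp Real.measurable_exp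

lemma _root_.Measurable.eexp {α : Type*} [MeasurableSpace α] {f : α → ℝ} (hf : Measurable f) :
    Measurable fun a => eexp (f a) :=
  measurable_eexp.comp hf

lemma eexp_pow (r : ℝ) (n : ℕ) : eexp r ^ n = eexp (n * r) := by
  rw [eexp, eexp, Real.exp_nat_mul, ENNReal.ofReal_pow (Real.exp_nonneg r)]

/-- The Chernoff bound. -/
lemma measure_le_eexp {P : Measure Ω} {f : Ω → ℝ} (hf : Measurable f) {l a M : ℝ}
    (hl : 0 ≤ l) (h : ∫⁻ ω, eexp (l * f ω) ∂P ≤ eexp M) :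
    P {ω | a ≤ f ω} ≤ eexp (M - l * a) := by
  calc P {ω | a ≤ f ω} ≤ P {ω | 1 ≤ eexp (l * f ω - l * a)} := by
        refine measure_mono fun ω (hω : a ≤ f ω) => ?_
        rw [Set.mem_ofPred_eq, ← eexp_zero]
        exact eexp_mono (by nlinarith)
    _ ≤ ∫⁻ ω, eexp (l * f ω - l * a) ∂P := by
        have := meas_ge_le_lintegral_div (μ := P) (f := fun ω => eexp (l * f ω - l * a))
          (((hf.const_mul l).sub_const _).eexp.aemeasurable) one_ne_zero ENNReal.one_ne_top
        simpa using this
    _ = (∫⁻ ω, eexp (l * f ω) ∂P) * eexp (-(l * a)) := by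
        simp_rw [sub_eq_add_neg, eexp_add]
        rw [lintegral_mul_const _ (hf.const_mul l).eexp]
    _ ≤ eexp (M - l * a) := by
        rw [sub_eq_add_neg, eexp_add]
        gcongr

/-- Jensen's inequality for a finite average in the exponent. -/
lemma eexp_sum_mul_le {ι : Type*} (s : Finset ι) (w f : ι → ℝ) (hw : ∀ i ∈ s, 0 ≤ w i)
    (hw1 : ∑ i ∈ s, w i = 1) :
    eexp (∑ i ∈ s, w i * f i) ≤ ∑ i ∈ s, ENNReal.ofReal (w i) * eexp (f i) := by
  have h := convexOn_exp.map_sum_le (p := f) hw hw1 fun _ _ => Set.mem_univ _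
  simp only [smul_eq_mul] at h
  refine (ENNReal.ofReal_le_ofReal h).trans ?_
  rw [ENNReal.ofReal_sum_of_nonneg fun i hi => mul_nonneg (hw i hi) (Real.exp_nonneg _)]
  refine Finset.sum_le_sum fun i hi => ?_
  rw [ENNReal.ofReal_mul (hw i hi), eexp]

/-- Averaging in the exponent does not increase an exponential moment bound that holds for every
term with positive weight. -/
lemma lintegral_eexp_sum_mul_le {ι : Type*} (s : Finset ι) (w : ι → ℝ) (f : ι → Ω → ℝ)
    (hf : ∀ i, Measurable (f i)) (hw : ∀ i ∈ s, 0 ≤ w i) (hw1 : ∑ i ∈ s, w i = 1)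
    {P : Measure Ω} {M : ℝ} (h : ∀ i ∈ s, w i ≠ 0 → ∫⁻ ω, eexp (f i ω) ∂P ≤ eexp M) :
    ∫⁻ ω, eexp (∑ i ∈ s, w i * f i ω) ∂P ≤ eexp M := by
  calc ∫⁻ ω, eexp (∑ i ∈ s, w i * f i ω) ∂P
      ≤ ∫⁻ ω, ∑ i ∈ s, ENNReal.ofReal (w i) * eexp (f i ω) ∂P :=
        lintegral_mono fun ω => eexp_sum_mul_le s w (fun i => f i ω) hw hw1
    _ = ∑ i ∈ s, ENNReal.ofReal (w i) * ∫⁻ ω, eexp (f i ω) ∂P := by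
        rw [lintegral_finsetSum _ fun i _ => (hf i).eexp.const_mul _]
        exact Finset.sum_congr rfl fun i _ => lintegral_const_mul _ (hf i).eexp
    _ ≤ ∑ i ∈ s, ENNReal.ofReal (w i) * eexp M := by
        refine Finset.sum_le_sum fun i hi => ?_
        by_cases h0 : w i = 0
        · simp [h0]
        · gcongr
          exact h i hi h0
    _ = eexp M := by
        rw [← Finset.sum_mul, ← ENNReal.ofReal_sum_of_nonneg hw, hw1, ENNReal.ofReal_one, one_mul]

lemma lintegral_eexp_le_of_integral {P : Measure Ω} {f : Ω → ℝ} {M : ℝ}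
    (hi : Integrable (fun ω => Real.exp (f ω)) P) (h : ∫ ω, Real.exp (f ω) ∂P ≤ Real.exp M) :
    ∫⁻ ω, eexp (f ω) ∂P ≤ eexp M := by
  unfold eexp
  rw [← ofReal_integral_eq_lintegral_ofReal hi (Filter.Eventually.of_forall fun _ =>
    Real.exp_nonneg _)]
  exact ENNReal.ofReal_le_ofReal h

/-! ### Scalar subgaussian variables -/

section Scalar

variable {P : Measure Ω} {v : Ω → ℝ} {κ : ℝ}

lemma integrable_exp_sq_div (hv : Measurable v)
    (h2 : ∫⁻ ω, eexp (v ω ^ 2 / κ ^ 2) ∂P ≤ 2) :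
    Integrable (fun ω => Real.exp (v ω ^ 2 / κ ^ 2)) P := by
  refine ⟨by fun_prop, ?_⟩
  rw [hasFiniteIntegral_iff_ofReal (Filter.Eventually.of_forall fun _ => Real.exp_nonneg _)]
  exact lt_of_le_of_lt h2 (by simp)

lemma integral_exp_sq_div_le (hv : Measurable v)
    (h2 : ∫⁻ ω, eexp (v ω ^ 2 / κ ^ 2) ∂P ≤ 2) :
    ∫ ω, Real.exp (v ω ^ 2 / κ ^ 2) ∂P ≤ 2 := by
  rw [integral_eq_lintegral_of_nonneg_ae (Filter.Eventually.of_forall fun _ => Real.exp_nonneg _)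
    (by fun_prop)]
  exact ENNReal.toReal_le_of_le_ofReal (by norm_num) (by simpa [eexp] using h2)

lemma pow_four_le_exp_sq_div (hκ : 0 < κ) (x : ℝ) :
    x ^ 4 ≤ 2 * κ ^ 4 * Real.exp (x ^ 2 / κ ^ 2) := by
  have h := Real.quadratic_le_exp_of_nonneg (show 0 ≤ x ^ 2 / κ ^ 2 by positivity)
  have h0 : 0 ≤ x ^ 2 / κ ^ 2 := by positivity
  have h1 : (x ^ 2 / κ ^ 2) ^ 2 ≤ 2 * Real.exp (x ^ 2 / κ ^ 2) := by linarith
  have h2 : x ^ 4 = κ ^ 4 * (x ^ 2 / κ ^ 2) ^ 2 := by field_simp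
  rw [h2]
  nlinarith [pow_pos hκ 4]

lemma integrable_pow_four (hκ : 0 < κ) (hv : Measurable v)
    (h2 : ∫⁻ ω, eexp (v ω ^ 2 / κ ^ 2) ∂P ≤ 2) : Integrable (fun ω => v ω ^ 4) P := by
  refine ((integrable_exp_sq_div hv h2).const_mul (2 * κ ^ 4)).mono' (by fun_prop) ?_
  refine Filter.Eventually.of_forall fun ω => ?_
  rw [Real.norm_of_nonneg (by positivity)]
  exact pow_four_le_exp_sq_div hκ _

lemma integral_pow_four_le (hκ : 0 < κ) (hv : Measurable v)
    (h2 : ∫⁻ ω, eexp (v ω ^ 2 / κ ^ 2) ∂P ≤ 2) : ∫ ω, v ω ^ 4 ∂P ≤ 4 * κ ^ 4 := by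
  calc ∫ ω, v ω ^ 4 ∂P ≤ ∫ ω, 2 * κ ^ 4 * Real.exp (v ω ^ 2 / κ ^ 2) ∂P :=
        integral_mono (integrable_pow_four hκ hv h2)
          ((integrable_exp_sq_div hv h2).const_mul _) fun ω => pow_four_le_exp_sq_div hκ _
    _ ≤ 2 * κ ^ 4 * 2 := by
        rw [integral_const_mul]
        gcongr
        exact integral_exp_sq_div_le hv h2
    _ = 4 * κ ^ 4 := by ring

variable [IsProbabilityMeasure P]

lemma memLp_two_of_subgaussian (hκ : 0 < κ) (hv : Measurable v)
    (h2 : ∫⁻ ω, eexp (v ω ^ 2 / κ ^ 2) ∂P ≤ 2) : MemLp v 2 P := by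
  rw [memLp_two_iff_integrable_sq hv.aestronglyMeasurable]
  refine ((integrable_pow_four hκ hv h2).add (integrable_const 1)).mono' (by fun_prop) ?_
  refine Filter.Eventually.of_forall fun ω => ?_
  rw [Real.norm_of_nonneg (by positivity), Pi.add_apply]
  nlinarith [sq_nonneg (v ω ^ 2 - 1)]

/-- For `s ∈ [0, 1]` the function `exp (s · a)` lies below its chord `1 - s + s exp a`. -/
lemma exp_mul_le_chord {s : ℝ} (h0 : 0 ≤ s) (h1 : s ≤ 1) (a : ℝ) :
    Real.exp (s * a) ≤ 1 - s + s * Real.exp a := by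
  have := convexOn_exp.2 (Set.mem_univ 0) (Set.mem_univ a) (sub_nonneg.2 h1) h0 (by ring)
  simpa using this

lemma exp_le_add_exp_sq (x : ℝ) : Real.exp x ≤ x + Real.exp (x ^ 2) := by
  have hsq := Real.add_one_le_exp (x ^ 2)
  by_cases h : |x| ≤ 1
  · have := Real.abs_exp_sub_one_sub_id_le h
    have := (abs_le.1 this).2
    linarith
  · rcases lt_or_ge 0 x with hx | hx
    · rw [abs_of_pos hx] at h
      have : Real.exp x ≤ Real.exp (x ^ 2) := Real.exp_le_exp.2 (by nlinarith)
      linarith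
    · rw [abs_of_nonpos hx] at h
      have : Real.exp x ≤ 1 := Real.exp_le_one_iff.2 hx
      nlinarith

/-- A centered subgaussian variable has a Gaussian moment generating function bound. -/
lemma lintegral_eexp_mul_le (hκ : 0 < κ) (hv : Measurable v)
    (h2 : ∫⁻ ω, eexp (v ω ^ 2 / κ ^ 2) ∂P ≤ 2) (h0 : ∫ ω, v ω ∂P = 0) (t : ℝ) :
    ∫⁻ ω, eexp (t * v ω) ∂P ≤ eexp (κ ^ 2 * t ^ 2) := by
  have hE := integrable_exp_sq_div hv h2
  have hE2 := integral_exp_sq_div_le hv h2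
  have hvi : Integrable v P := (memLp_two_of_subgaussian hκ hv h2).integrable one_le_two
  have chord : ∀ s : ℝ, 0 ≤ s →
      Integrable (fun ω => 1 - s + s * Real.exp (v ω ^ 2 / κ ^ 2)) P ∧
      ∫ ω, (1 - s + s * Real.exp (v ω ^ 2 / κ ^ 2)) ∂P ≤ Real.exp s := fun s hs => by
    refine ⟨(integrable_const _).add (hE.const_mul s), ?_⟩
    rw [integral_add (integrable_const _) (hE.const_mul s), integral_const_mul]
    simp only [integral_const, probReal_univ, one_smul]
    nlinarith [Real.add_one_le_exp s]
  rcases le_or_gt (κ ^ 2 * t ^ 2) 1 with ht | ht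
  · set s := κ ^ 2 * t ^ 2 with hs
    obtain ⟨hi, hle⟩ := chord s (by positivity)
    have hpt : ∀ ω, Real.exp (t * v ω) ≤ t * v ω + (1 - s + s * Real.exp (v ω ^ 2 / κ ^ 2)) :=
      fun ω => by
        refine (exp_le_add_exp_sq _).trans ?_
        gcongr
        refine le_trans (le_of_eq ?_) (exp_mul_le_chord (by positivity) ht _)
        congr 1
        rw [hs]
        field_simp
    have hi' := (hvi.const_mul t).add hi
    have hint : Integrable (fun ω => Real.exp (t * v ω)) P := by
      refine hi'.mono' (by fun_prop) (Filter.Eventually.of_forall fun ω => ?_)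
      rw [Real.norm_of_nonneg (Real.exp_nonneg _)]
      exact hpt ω
    refine lintegral_eexp_le_of_integral hint ((integral_mono hint hi' hpt).trans ?_)
    rw [integral_add' (hvi.const_mul t) hi, integral_const_mul, h0]
    simpa using hle
  · obtain ⟨hi, hle⟩ := chord (1 / 2) (by norm_num)
    -- Here the product is split by the inequality of arithmetic and geometric means.
    have hpt : ∀ ω, Real.exp (t * v ω) ≤ Real.exp (κ ^ 2 * t ^ 2 / 2) *
        (1 - 1 / 2 + 1 / 2 * Real.exp (v ω ^ 2 / κ ^ 2)) := fun ω => by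
      refine le_trans ?_ (mul_le_mul_of_nonneg_left
        (exp_mul_le_chord (s := 1 / 2) (by norm_num) (by norm_num) _) (Real.exp_nonneg _))
      rw [← Real.exp_add]
      refine Real.exp_le_exp.2 ?_
      have h : (κ * t - v ω / κ) ^ 2 = κ ^ 2 * t ^ 2 - 2 * (t * v ω) + v ω ^ 2 / κ ^ 2 := by
        field_simp
        ring
      nlinarith [sq_nonneg (κ * t - v ω / κ)]
    have hi' := hi.const_mul (Real.exp (κ ^ 2 * t ^ 2 / 2))
    have hint : Integrable (fun ω => Real.exp (t * v ω)) P := by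
      refine hi'.mono' (by fun_prop) (Filter.Eventually.of_forall fun ω => ?_)
      rw [Real.norm_of_nonneg (Real.exp_nonneg _)]
      exact hpt ω
    refine lintegral_eexp_le_of_integral hint ((integral_mono hint hi' hpt).trans ?_)
    rw [integral_const_mul]
    refine (mul_le_mul_of_nonneg_left hle (Real.exp_nonneg _)).trans ?_
    rw [← Real.exp_add]
    exact Real.exp_le_exp.2 (by linarith)

lemma exp_le_quadratic_mul_exp_abs (x : ℝ) :
    Real.exp x ≤ 1 + x + x ^ 2 * Real.exp |x| := by
  have h := Complex.norm_exp_sub_sum_le_norm_mul_exp (x : ℂ) 2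
  simp only [Finset.sum_range_succ, Finset.sum_range_zero, pow_zero, Nat.factorial_zero, pow_one,
    Nat.factorial_one, Nat.cast_one, div_one, zero_add, Complex.norm_real, Real.norm_eq_abs,
    sq_abs] at h
  have h' : |Real.exp x - (1 + x)| ≤ x ^ 2 * Real.exp |x| := by
    rw [← Real.norm_eq_abs (Real.exp x - (1 + x)), ← Complex.norm_real]
    push_cast
    exact h
  linarith [(abs_le.1 h').2]

/-- The square of a subgaussian variable is subexponential. -/
lemma lintegral_eexp_mul_sq_le (hκ : 0 < κ) (hv : Measurable v)
    (h2 : ∫⁻ ω, eexp (v ω ^ 2 / κ ^ 2) ∂P ≤ 2) {l : ℝ} (hl : 2 * κ ^ 2 * |l| ≤ 1) :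
    ∫⁻ ω, eexp (l * v ω ^ 2) ∂P ≤ eexp (l * (∫ ω, v ω ^ 2 ∂P) + 16 * l ^ 2 * κ ^ 4) := by
  have hE := integrable_exp_sq_div hv h2
  have hE2 := integral_exp_sq_div_le hv h2
  have hvi : Integrable (fun ω => v ω ^ 2) P := (memLp_two_of_subgaussian hκ hv h2).integrable_sq
  have hpt : ∀ ω, Real.exp (l * v ω ^ 2) ≤
      1 + l * v ω ^ 2 + 8 * l ^ 2 * κ ^ 4 * Real.exp (v ω ^ 2 / κ ^ 2) := fun ω => by
    refine (exp_le_quadratic_mul_exp_abs _).trans ?_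
    gcongr 1 + _ + ?_
    set w := v ω ^ 2 / κ ^ 2 with hw
    have hw0 : 0 ≤ w := by positivity
    have hvw : v ω ^ 2 = κ ^ 2 * w := by rw [hw]; field_simp
    have h1 : |l * v ω ^ 2| ≤ w / 2 := by
      rw [hvw, abs_mul, abs_of_nonneg (by positivity : 0 ≤ κ ^ 2 * w)]
      nlinarith
    have h3 : w ^ 2 ≤ 8 * Real.exp (w / 2) := by
      have := Real.quadratic_le_exp_of_nonneg (show 0 ≤ w / 2 by positivity)
      nlinarith
    calc (l * v ω ^ 2) ^ 2 * Real.exp |l * v ω ^ 2|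
        ≤ (l * v ω ^ 2) ^ 2 * Real.exp (w / 2) := by gcongr
      _ = l ^ 2 * κ ^ 4 * w ^ 2 * Real.exp (w / 2) := by rw [hvw]; ring
      _ ≤ l ^ 2 * κ ^ 4 * (8 * Real.exp (w / 2)) * Real.exp (w / 2) := by gcongr
      _ = 8 * l ^ 2 * κ ^ 4 * (Real.exp (w / 2) * Real.exp (w / 2)) := by ring
      _ = 8 * l ^ 2 * κ ^ 4 * Real.exp w := by rw [← Real.exp_add]; ring_nf
  have hi1 : Integrable (fun ω => 1 + l * v ω ^ 2) P := (integrable_const _).add (hvi.const_mul l)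
  have hi2 := hE.const_mul (8 * l ^ 2 * κ ^ 4)
  have hint : Integrable (fun ω => Real.exp (l * v ω ^ 2)) P := by
    refine (hi1.add hi2).mono' (by fun_prop) (Filter.Eventually.of_forall fun ω => ?_)
    rw [Real.norm_of_nonneg (Real.exp_nonneg _)]
    exact hpt ω
  refine lintegral_eexp_le_of_integral hint ((integral_mono hint (hi1.add hi2) hpt).trans ?_)
  rw [integral_add' hi1 hi2, integral_add (integrable_const _) (hvi.const_mul l),
    integral_const_mul, integral_const_mul]
  simp only [integral_const, probReal_univ, one_smul]
  have h3 : 8 * l ^ 2 * κ ^ 4 * ∫ ω, Real.exp (v ω ^ 2 / κ ^ 2) ∂P ≤ 8 * l ^ 2 * κ ^ 4 * 2 := by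
    gcongr
  have := Real.add_one_le_exp (l * (∫ ω, v ω ^ 2 ∂P) + 16 * l ^ 2 * κ ^ 4)
  linarith

end Scalar

/-! ### The squared norm of a subgaussian vector -/

lemma lintegral_eexp_mul_gaussianReal (t : ℝ) :
    ∫⁻ g, eexp (t * g) ∂(gaussianReal 0 1) = eexp (t ^ 2 / 2) := by
  have h := congrFun (mgf_id_gaussianReal (μ := 0) (v := 1)) t
  simp only [mgf, id, zero_mul, NNReal.coe_one, one_mul, zero_add] at h
  unfold eexp
  rw [← ofReal_integral_eq_lintegral_ofReal (integrable_exp_mul_gaussianReal t)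
    (Filter.Eventually.of_forall fun _ => Real.exp_nonneg _), h]

lemma lintegral_eexp_mul_sq_gaussianReal_le {s : ℝ} (h0 : 0 ≤ s) (h1 : s ≤ 1 / 4) :
    ∫⁻ g, eexp (s * g ^ 2) ∂(gaussianReal 0 1) ≤ eexp (2 * s) := by
  have hb : 0 < 1 / 2 - s := by linarith
  rw [gaussianReal_of_var_ne_zero 0 one_ne_zero,
    lintegral_withDensity_eq_lintegral_mul _ (measurable_gaussianPDF 0 1)
      (by fun_prop : Measurable fun g : ℝ => s * g ^ 2).eexp]
  have hpt : ∀ g : ℝ, (gaussianPDF 0 1 * fun g => eexp (s * g ^ 2)) g =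
      ENNReal.ofReal ((√(2 * Real.pi))⁻¹ * Real.exp (-(1 / 2 - s) * g ^ 2)) := fun g => by
    simp only [Pi.mul_apply, gaussianPDF, gaussianPDFReal, eexp]
    rw [← ENNReal.ofReal_mul (by positivity), mul_assoc, ← Real.exp_add]
    congr 2
    · simp
    · congr 1; simp; ring
  rw [lintegral_congr hpt, ← ofReal_integral_eq_lintegral_ofReal
    ((integrable_exp_neg_mul_sq hb).const_mul _)
    (Filter.Eventually.of_forall fun _ => by positivity), integral_const_mul, integral_gaussian,
    eexp]
  refine ENNReal.ofReal_le_ofReal ?_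
  rw [← Real.sqrt_inv, ← Real.sqrt_mul (by positivity)]
  refine Real.sqrt_le_iff.2 ⟨Real.exp_nonneg _, ?_⟩
  have he := Real.add_one_le_exp (4 * s)
  rw [← Real.exp_nat_mul, show ((2 : ℕ) : ℝ) * (2 * s) = 4 * s by push_cast; ring]
  have : (2 * Real.pi)⁻¹ * (Real.pi / (1 / 2 - s)) = 1 / (1 - 2 * s) := by
    have : 1 - 2 * s ≠ 0 := by linarith
    field_simp
  rw [this, div_le_iff₀ (by linarith)]
  nlinarith

/-- Fubini for a product of functions of the coordinates of a product of probability measures. -/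
lemma lintegral_pi_prod_eval {ι : Type*} [Fintype ι] {α : ι → Type*}
    [∀ i, MeasurableSpace (α i)] (μ : ∀ i, Measure (α i)) [∀ i, IsProbabilityMeasure (μ i)]
    (f : ∀ i, α i → ENNReal) (hf : ∀ i, Measurable (f i)) :
    ∫⁻ g, ∏ i, f i (g i) ∂(Measure.pi μ) = ∏ i, ∫⁻ a, f i a ∂(μ i) := by
  have := lintegral_prod_eq_prod_lintegral_of_indepFun (μ := Measure.pi μ) Finset.univ
    (fun i g => f i (g i)) (iIndepFun_pi fun i => (hf i).aemeasurable)
    fun i => (hf i).comp (measurable_pi_apply i)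
  rw [this]
  exact Finset.prod_congr rfl fun i _ =>
    (measurePreserving_eval μ i).lintegral_comp (hf i)

/-- A vector all of whose linear forms have subgaussian exponential moments has a subexponential
squared norm. The square in the exponent is linearised by an independent standard Gaussian vector
`g`: one has `exp (a |Y|²) = 𝔼 exp (√(2a) ⟨g, Y⟩)`. -/
lemma lintegral_eexp_mul_sum_sq_le {ι : Type*} [Fintype ι] {P : Measure Ω} [SFinite P]
    {Y : Ω → ι → ℝ} (hY : Measurable Y) {K a : ℝ} (hK : 0 ≤ K) (ha : 0 ≤ a)
    (haK : 8 * a * K ≤ 1)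
    (h : ∀ u : ι → ℝ, ∫⁻ ω, eexp (∑ i, u i * Y ω i) ∂P ≤ eexp (K * ∑ i, u i ^ 2)) :
    ∫⁻ ω, eexp (a * ∑ i, Y ω i ^ 2) ∂P ≤ eexp (4 * a * K * Fintype.card ι) := by
  have hYi : ∀ i, Measurable fun ω => Y ω i := fun i => measurable_pi_iff.1 hY i
  have hlin : ∀ ω, eexp (a * ∑ i, Y ω i ^ 2) =
      ∫⁻ g, eexp (∑ i, √(2 * a) * g i * Y ω i) ∂(Measure.pi fun _ : ι => gaussianReal 0 1) :=
    fun ω => by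
      simp_rw [eexp_sum]
      rw [lintegral_pi_prod_eval (fun _ : ι => gaussianReal 0 1)
        (fun i g => eexp (√(2 * a) * g * Y ω i)) fun i =>
          Measurable.eexp (by fun_prop), Finset.mul_sum, eexp_sum]
      refine Finset.prod_congr rfl fun i _ => ?_
      have := lintegral_eexp_mul_gaussianReal (√(2 * a) * Y ω i)
      rw [mul_pow, Real.sq_sqrt (by positivity)] at this
      rw [show a * Y ω i ^ 2 = 2 * a * Y ω i ^ 2 / 2 by ring, ← this]
      refine lintegral_congr fun g => ?_
      ring_nf
  rw [lintegral_congr hlin, lintegral_lintegral_swap]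
  · calc ∫⁻ g, ∫⁻ ω, eexp (∑ i, √(2 * a) * g i * Y ω i) ∂P
          ∂(Measure.pi fun _ : ι => gaussianReal 0 1)
        ≤ ∫⁻ g, ∏ i, eexp (2 * a * K * g i ^ 2) ∂(Measure.pi fun _ : ι => gaussianReal 0 1) := by
          refine lintegral_mono fun g => (h fun i => √(2 * a) * g i).trans (le_of_eq ?_)
          rw [← eexp_sum, Finset.mul_sum]
          congr 1
          refine Finset.sum_congr rfl fun i _ => ?_
          rw [mul_pow, Real.sq_sqrt (by positivity)]
          ring
      _ = ∏ _i : ι, ∫⁻ g, eexp (2 * a * K * g ^ 2) ∂(gaussianReal 0 1) :=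
          lintegral_pi_prod_eval _ (fun _ g => eexp (2 * a * K * g ^ 2)) fun _ =>
            Measurable.eexp (by fun_prop)
      _ ≤ ∏ _i : ι, eexp (2 * (2 * a * K)) := by
          refine Finset.prod_le_prod' fun i _ =>
            lintegral_eexp_mul_sq_gaussianReal_le (by positivity) (by linarith)
      _ = eexp (4 * a * K * Fintype.card ι) := by
          rw [Finset.prod_const, eexp_pow, Finset.card_univ]
          congr 1
          ring
  · refine (Measurable.eexp ?_).aemeasurable
    refine Finset.measurable_sum _ fun i _ => ?_
    exact ((measurable_pi_apply i).comp measurable_snd |>.const_mul _).mul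
      ((hYi i).comp measurable_fst)

/-! ### Independence -/

lemma _root_.ProbabilityTheory.IndepFun.lintegral_comp_pair {α β : Type*} [MeasurableSpace α]
    [MeasurableSpace β] {P : Measure Ω} [IsProbabilityMeasure P] {Y : Ω → α} {Z : Ω → β}
    (h : IndepFun Y Z P) (hY : Measurable Y) (hZ : Measurable Z) {f : α → β → ENNReal}
    (hf : Measurable (Function.uncurry f)) :
    ∫⁻ ω, f (Y ω) (Z ω) ∂P = ∫⁻ ω, ∫⁻ ω', f (Y ω) (Z ω') ∂P ∂P := by
  have h1 : ∫⁻ ω, f (Y ω) (Z ω) ∂P =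
      ∫⁻ p, Function.uncurry f p ∂(P.map fun ω => (Y ω, Z ω)) := by
    rw [lintegral_map hf (hY.prodMk hZ)]
    rfl
  have := Measure.isProbabilityMeasure_map (μ := P) hZ.aemeasurable
  rw [h1, (indepFun_iff_map_prod_eq_prod_map_map hY.aemeasurable hZ.aemeasurable).1 h,
    lintegral_prod _ hf.aemeasurable, lintegral_map hf.lintegral_prod_right' hY]
  refine lintegral_congr fun ω => ?_
  rw [lintegral_map (f := fun y => Function.uncurry f (Y ω, y))
    (hf.comp measurable_prodMk_left) hZ]
  rfl

lemma lintegral_eexp_linear_le {n : ℕ} {τ : Type*} [Fintype τ] {P : Measure Ω}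
    {x : Fin n → Ω → τ → ℝ} (hx : ∀ i, Measurable (x i)) (hind : iIndepFun x P) {K : ℝ}
    (hK : ∀ i (u : τ → ℝ), ∫⁻ ω, eexp (∑ a, u a * x i ω a) ∂P ≤ eexp (K * ∑ a, u a ^ 2))
    (J : Finset (Fin n)) (u : Fin n → τ → ℝ) :
    ∫⁻ ω, eexp (∑ j ∈ J, ∑ a, u j a * x j ω a) ∂P ≤ eexp (K * ∑ j ∈ J, ∑ a, u j a ^ 2) := by
  have hm : ∀ j, Measurable fun y : τ → ℝ => eexp (∑ a, u j a * y a) := fun j =>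
    Measurable.eexp (by fun_prop)
  simp_rw [eexp_sum J]
  rw [lintegral_prod_eq_prod_lintegral_of_indepFun J
    (fun j ω => eexp (∑ a, u j a * x j ω a)) (hind.comp _ hm) fun j => (hm j).comp (hx j),
    Finset.mul_sum, eexp_sum]
  exact Finset.prod_le_prod' fun j _ => hK j (u j)

/-! ### The off-diagonal part of the bag sums -/

/-- The sum of the inner products `⟨xᵢ, xⱼ⟩` over the ordered pairs of distinct samples that lie in
a common bag. -/
noncomputable def bagChaos {n m : ℕ} {τ : Type*} [Fintype τ] (b : Fin n → Fin m)
    (x : Fin n → τ → ℝ) : ℝ :=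
  ∑ i, ∑ j, if i ≠ j ∧ b i = b j then ∑ a, x i a * x j a else 0

lemma card_filter_mem_notMem {n : ℕ} {i j : Fin n} (hij : i ≠ j) :
    4 * (Finset.univ.filter fun I : Finset (Fin n) => i ∈ I ∧ j ∉ I).card = 2 ^ n := by
  have hcard : (Finset.univ.filter fun I : Finset (Fin n) => i ∈ I ∧ j ∉ I).card =
      ({i, j}ᶜ : Finset (Fin n)).powerset.card := by
    refine Finset.card_nbij' (fun I => I.erase i) (fun I => insert i I) ?_ ?_ ?_ ?_
    · intro I hI
      simp only [Finset.coe_filter, Finset.mem_univ, true_and, Set.mem_ofPred_eq] at hI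
      simp only [Finset.coe_powerset, Set.mem_preimage, Set.mem_powerset_iff, Finset.coe_subset]
      intro l hl
      simp only [Finset.mem_compl, Finset.mem_insert, Finset.mem_singleton, not_or]
      grind
    · intro I hI
      simp only [Finset.coe_powerset, Set.mem_preimage, Set.mem_powerset_iff,
        Finset.coe_subset] at hI
      have hj : j ∉ I := fun h => by simpa using hI h
      simp [hj, hij.symm]
    · intro I hI
      simp only [Finset.coe_filter, Finset.mem_univ, true_and, Set.mem_ofPred_eq] at hI
      exact Finset.insert_erase hI.1
    · intro I hI
      simp only [Finset.coe_powerset, Set.mem_preimage, Set.mem_powerset_iff,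
        Finset.coe_subset] at hI
      exact Finset.erase_insert fun h => by simpa using hI h
  have hn : 2 ≤ n := by
    have h2 := Finset.card_le_univ ({i, j} : Finset (Fin n))
    rwa [Finset.card_pair hij, Fintype.card_fin] at h2
  rw [hcard, Finset.card_powerset, Finset.card_compl, Finset.card_pair hij, Fintype.card_fin]
  obtain ⟨q, rfl⟩ := Nat.exists_eq_add_of_le hn
  rw [Nat.add_sub_cancel_left, pow_add]
  norm_num

/-- Decoupling: an off-diagonal double sum is four times the average, over all sets `I` of indices,
of its restriction to `I × Iᶜ`. -/
lemma sum_offDiag_eq_average {n : ℕ} (h : Fin n → Fin n → ℝ) :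
    ∑ i, ∑ j, (if i ≠ j then h i j else 0) =
      ∑ I : Finset (Fin n), (1 / 2 ^ n : ℝ) * (4 * ∑ i ∈ I, ∑ j ∈ Iᶜ, h i j) := by
  have h1 : ∀ I : Finset (Fin n), ∑ i ∈ I, ∑ j ∈ Iᶜ, h i j =
      ∑ i, ∑ j, if i ∈ I ∧ j ∉ I then h i j else 0 := fun I => by
    have h2 : ∀ i, ∑ j ∈ Iᶜ, h i j = ∑ j, if j ∈ Iᶜ then h i j else 0 := fun i => by
      rw [Finset.sum_ite_mem, Finset.univ_inter]
    have h3 : ∀ f : Fin n → ℝ, ∑ i ∈ I, f i = ∑ i, if i ∈ I then f i else 0 := fun f => by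
      rw [Finset.sum_ite_mem, Finset.univ_inter]
    simp_rw [h2]
    rw [h3]
    simp_rw [ite_and, Finset.sum_ite_irrel, Finset.mem_compl, Finset.sum_const_zero]
  simp_rw [h1]
  rw [← Finset.mul_sum, ← Finset.mul_sum,
    Finset.sum_comm (s := (Finset.univ : Finset (Finset (Fin n)))), Finset.mul_sum, Finset.mul_sum]
  refine Finset.sum_congr rfl fun i _ => ?_
  rw [Finset.sum_comm (s := (Finset.univ : Finset (Finset (Fin n)))), Finset.mul_sum, Finset.mul_sum]
  refine Finset.sum_congr rfl fun j _ => ?_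
  rw [← Finset.sum_filter, Finset.sum_const, nsmul_eq_mul]
  by_cases hij : i = j
  · subst hij
    simp
  · rw [if_pos hij]
    have := card_filter_mem_notMem hij
    have h2 : (4 : ℝ) * ((Finset.univ.filter fun I : Finset (Fin n) => i ∈ I ∧ j ∉ I).card : ℝ)
      = 2 ^ n := by exact_mod_cast this
    rw [← mul_assoc 4, h2]
    field_simp

/-- The sum of the samples in the bag `l`, restricted to the indices in `I`. -/
noncomputable def partialBagSum {n m : ℕ} {τ : Type*} (b : Fin n → Fin m) (I : Finset (Fin n))
    (x : Fin n → τ → ℝ) (l : Fin m) (a : τ) : ℝ :=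
  ∑ i ∈ I, if b i = l then x i a else 0

lemma sum_comp_le_of_card_bag_le {n m k : ℕ} {b : Fin n → Fin m}
    (hb : ∀ l, (bag b l).card ≤ k) (I : Finset (Fin n)) {f : Fin m → ℝ} (hf : ∀ l, 0 ≤ f l) :
    ∑ i ∈ I, f (b i) ≤ k * ∑ l, f l := by
  calc ∑ i ∈ I, f (b i) ≤ ∑ i, f (b i) :=
        Finset.sum_le_sum_of_subset_of_nonneg (Finset.subset_univ I) fun _ _ _ => hf _
    _ = ∑ l, (bag b l).card * f l := by
        rw [← Finset.sum_fiberwise Finset.univ b]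
        refine Finset.sum_congr rfl fun l _ => ?_
        rw [Finset.sum_congr rfl (g := fun _ => f l) fun i hi => by
          rw [(Finset.mem_filter.1 hi).2], Finset.sum_const, nsmul_eq_mul]
        rfl
    _ ≤ ∑ l, k * f l := by
        refine Finset.sum_le_sum fun l _ => mul_le_mul_of_nonneg_right ?_ (hf l)
        exact_mod_cast hb l
    _ = k * ∑ l, f l := by rw [Finset.mul_sum]

lemma sum_partialBagSum_mul {n m : ℕ} {τ : Type*} [Fintype τ] (b : Fin n → Fin m)
    (I : Finset (Fin n)) (x : Fin n → τ → ℝ) (u : Fin m × τ → ℝ) :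
    ∑ q : Fin m × τ, u q * partialBagSum b I x q.1 q.2 =
      ∑ i ∈ I, ∑ a, u (b i, a) * x i a := by
  rw [Fintype.sum_prod_type]
  simp_rw [partialBagSum, Finset.mul_sum, mul_ite, mul_zero]
  rw [Finset.sum_comm]
  rw [Finset.sum_comm (s := I)]
  refine Finset.sum_congr rfl fun a _ => ?_
  rw [Finset.sum_comm]
  refine Finset.sum_congr rfl fun i _ => ?_
  simp

/-- The exponential moment of the decoupled chaos. Conditionally on the samples in `I` it is a
linear form in the remaining samples, and what is left is the squared norm of the vector of partial
bag sums. -/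
lemma lintegral_eexp_decoupled_le {n m k : ℕ} {τ : Type*} [Fintype τ] {P : Measure Ω}
    [IsProbabilityMeasure P] {x : Fin n → Ω → τ → ℝ} (hx : ∀ i, Measurable (x i))
    (hind : iIndepFun x P) {K : ℝ} (hK0 : 0 ≤ K)
    (hK : ∀ i (u : τ → ℝ), ∫⁻ ω, eexp (∑ a, u a * x i ω a) ∂P ≤ eexp (K * ∑ a, u a ^ 2))
    {b : Fin n → Fin m} (hb : ∀ l, (bag b l).card ≤ k) (I : Finset (Fin n)) {c : ℝ}
    (hc : 8 * c ^ 2 * K ^ 2 * k ^ 2 ≤ 1) :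
    ∫⁻ ω, eexp (c * ∑ j ∈ Iᶜ, ∑ a, partialBagSum b I (fun i => x i ω) (b j) a * x j ω a) ∂P ≤
      eexp (4 * c ^ 2 * K ^ 2 * k ^ 2 * (m * Fintype.card τ)) := by
  -- The samples inside and outside `I` form independent blocks.
  let G : (I → τ → ℝ) → Fin m × τ → ℝ :=
    fun y q => ∑ i : I, if b i = q.1 then y i q.2 else 0
  let S : Ω → Fin m × τ → ℝ := fun ω q => partialBagSum b I (fun i => x i ω) q.1 q.2
  let Z : Ω → (Iᶜ : Finset (Fin n)) → τ → ℝ := fun ω j => x j ω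
  have hGm : Measurable G := by
    refine measurable_pi_lambda _ fun q => Finset.measurable_sum _ fun i _ => ?_
    by_cases h : b i = q.1
    · simp only [h, if_true]; fun_prop
    · simp only [h, if_false]; fun_prop
  have hSG : S = G ∘ fun ω (i : I) => x i ω := by
    funext ω q
    exact (Finset.sum_coe_sort I fun i => if b i = q.1 then x i ω q.2 else 0).symm
  have hXI : Measurable fun ω (i : I) => x i ω := measurable_pi_lambda _ fun i => hx i
  have hS : Measurable S := hSG ▸ hGm.comp hXI
  have hZ : Measurable Z := measurable_pi_lambda _ fun j => hx j
  have hSZ : IndepFun S Z P := by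
    have := hind.indepFun_finset I Iᶜ disjoint_compl_right hx
    rw [hSG]
    exact this.comp hGm measurable_id
  let F : (Fin m × τ → ℝ) → ((Iᶜ : Finset (Fin n)) → τ → ℝ) → ENNReal :=
    fun s z => eexp (∑ j : (Iᶜ : Finset (Fin n)), ∑ a, c * s (b j, a) * z j a)
  have hF : Measurable (Function.uncurry F) := by
    refine Measurable.eexp ?_
    refine Finset.measurable_sum _ fun j _ => Finset.measurable_sum _ fun a _ => ?_
    refine Measurable.mul ?_ ?_
    · exact Measurable.const_mul (f := fun p : (Fin m × τ → ℝ) × _ => p.1 (b j, a))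
        ((measurable_pi_apply (b j, a)).comp measurable_fst) c
    · exact (measurable_pi_apply a).comp ((measurable_pi_apply j).comp measurable_snd)
  have hFcoe : ∀ (s : Fin m × τ → ℝ) ω, F s (Z ω) =
      eexp (∑ j ∈ Iᶜ, ∑ a, c * s (b j, a) * x j ω a) := fun s ω => by
    simp only [F, Z]
    rw [Finset.sum_coe_sort (Iᶜ) fun j => ∑ a, c * s (b j, a) * x j ω a]
  have hstart : ∀ ω,
      eexp (c * ∑ j ∈ Iᶜ, ∑ a, partialBagSum b I (fun i => x i ω) (b j) a * x j ω a) =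
        F (S ω) (Z ω) := fun ω => by
    rw [hFcoe, Finset.mul_sum]
    simp_rw [Finset.mul_sum, ← mul_assoc]
    rfl
  rw [lintegral_congr hstart, hSZ.lintegral_comp_pair hS hZ hF]
  have hinner : ∀ ω, ∫⁻ ω', F (S ω) (Z ω') ∂P ≤ eexp (c ^ 2 * K * k * ∑ q, S ω q ^ 2) := fun ω => by
    simp_rw [hFcoe]
    refine (lintegral_eexp_linear_le hx hind hK Iᶜ fun j a => c * S ω (b j, a)).trans
      (eexp_mono ?_)
    have := sum_comp_le_of_card_bag_le hb Iᶜ (f := fun l => ∑ a, S ω (l, a) ^ 2)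
      fun l => Finset.sum_nonneg fun a _ => sq_nonneg _
    rw [Fintype.sum_prod_type]
    simp_rw [mul_pow, ← Finset.mul_sum]
    calc K * (c ^ 2 * ∑ j ∈ Iᶜ, ∑ a, S ω (b j, a) ^ 2)
        ≤ K * (c ^ 2 * (k * ∑ l, ∑ a, S ω (l, a) ^ 2)) := by gcongr
      _ = _ := by ring
  refine (lintegral_mono hinner).trans ?_
  have hmain := lintegral_eexp_mul_sum_sq_le (P := P) hS (K := K * k) (a := c ^ 2 * K * k)
    (by positivity) (by positivity) (by nlinarith) fun u => by
      simp only [S]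
      simp_rw [sum_partialBagSum_mul]
      refine (lintegral_eexp_linear_le hx hind hK I fun i a => u (b i, a)).trans (eexp_mono ?_)
      have := sum_comp_le_of_card_bag_le hb I (f := fun l => ∑ a, u (l, a) ^ 2)
        fun l => Finset.sum_nonneg fun a _ => sq_nonneg _
      rw [Fintype.sum_prod_type, mul_assoc]
      gcongr
  refine hmain.trans (eexp_mono (le_of_eq ?_))
  rw [Fintype.card_prod, Fintype.card_fin]
  push_cast
  ring

lemma measurable_bagChaos {n m : ℕ} {τ : Type*} [Fintype τ] (b : Fin n → Fin m) :
    Measurable (bagChaos b : (Fin n → τ → ℝ) → ℝ) := by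
  unfold bagChaos
  refine Finset.measurable_sum _ fun i _ => Finset.measurable_sum _ fun j _ => ?_
  split_ifs
  · fun_prop
  · fun_prop

/-- An exponential moment bound of Hanson–Wright type for the off-diagonal part of the bag sums. -/
lemma lintegral_eexp_bagChaos_le {n m k : ℕ} {τ : Type*} [Fintype τ] {P : Measure Ω}
    [IsProbabilityMeasure P] {x : Fin n → Ω → τ → ℝ} (hx : ∀ i, Measurable (x i))
    (hind : iIndepFun x P) {K : ℝ} (hK0 : 0 ≤ K)
    (hK : ∀ i (u : τ → ℝ), ∫⁻ ω, eexp (∑ a, u a * x i ω a) ∂P ≤ eexp (K * ∑ a, u a ^ 2))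
    {b : Fin n → Fin m} (hb : ∀ l, (bag b l).card ≤ k) {c : ℝ}
    (hc : 128 * c ^ 2 * K ^ 2 * k ^ 2 ≤ 1) :
    ∫⁻ ω, eexp (c * bagChaos b fun i => x i ω) ∂P ≤
      eexp (64 * c ^ 2 * K ^ 2 * k ^ 2 * (m * Fintype.card τ)) := by
  have hxa : ∀ i a, Measurable fun ω => x i ω a := fun i a => measurable_pi_iff.1 (hx i) a
  have hS : ∀ I l a, Measurable fun ω => partialBagSum b I (fun i => x i ω) l a := fun I l a => by
    unfold partialBagSum
    refine Finset.measurable_sum _ fun i _ => ?_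
    by_cases h : b i = l
    · simp only [h, if_true]; exact hxa i a
    · simp only [h, if_false]; fun_prop
  have hdec : ∀ ω, c * bagChaos b (fun i => x i ω) = ∑ I : Finset (Fin n), (1 / 2 ^ n : ℝ) *
      (4 * c * ∑ j ∈ Iᶜ, ∑ a, partialBagSum b I (fun i => x i ω) (b j) a * x j ω a) := fun ω => by
    unfold bagChaos
    simp_rw [ite_and]
    rw [sum_offDiag_eq_average, Finset.mul_sum]
    refine Finset.sum_congr rfl fun I _ => ?_
    have : ∑ i ∈ I, ∑ j ∈ Iᶜ, (if b i = b j then ∑ a, x i ω a * x j ω a else 0) =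
        ∑ j ∈ Iᶜ, ∑ a, partialBagSum b I (fun i => x i ω) (b j) a * x j ω a := by
      rw [Finset.sum_comm]
      refine Finset.sum_congr rfl fun j _ => ?_
      simp_rw [partialBagSum, Finset.sum_mul]
      rw [Finset.sum_comm]
      refine Finset.sum_congr rfl fun i _ => ?_
      split_ifs <;> simp
    rw [this]
    ring
  rw [lintegral_congr fun ω => congrArg eexp (hdec ω)]
  refine lintegral_eexp_sum_mul_le _ _ _ (fun I => ?_) (fun _ _ => by positivity) ?_ ?_
  · exact (Finset.measurable_sum _ fun j _ => Finset.measurable_sum _ fun a _ =>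
      (hS I _ a).mul (hxa j a)).const_mul _
  · rw [Finset.sum_const, Finset.card_univ, Fintype.card_finset, Fintype.card_fin, nsmul_eq_mul]
    push_cast
    field_simp
  · intro I _ _
    refine (lintegral_eexp_decoupled_le hx hind hK0 hK hb I (c := 4 * c) (by nlinarith)).trans
      (eexp_mono (le_of_eq (by ring)))

/-! ### Nets and the norm of a symmetric operator -/

section Net

variable {E : Type*} [NormedAddCommGroup E] [NormedSpace ℝ E] [FiniteDimensional ℝ E]

/-- The unit sphere has a `1/2`-net, contained in the sphere, of at most `5 ^ dim` points: a
`1/2`-separated subset of maximal cardinality. -/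
lemma exists_finset_net_sphere : ∃ N : Finset E, N.card ≤ 5 ^ Module.finrank ℝ E ∧
    (∀ u ∈ N, ‖u‖ = 1) ∧ ∀ x : E, ‖x‖ = 1 → ∃ u ∈ N, ‖x - u‖ ≤ 1 / 2 := by
  classical
  let Q : Finset E → Prop := fun s =>
    (∀ c ∈ s, ‖c‖ = 1) ∧ ∀ c ∈ s, ∀ c' ∈ s, c ≠ c' → 1 / 2 ≤ ‖c - c'‖
  have hQ : ∀ s, Q s → s.card ≤ 5 ^ Module.finrank ℝ E := fun s hs => by
    have hinj : Function.Injective fun c : E => (2 : ℝ) • c :=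
      smul_right_injective E two_ne_zero
    rw [← Finset.card_image_of_injective s hinj]
    refine Besicovitch.card_le_of_separated _ ?_ ?_
    · intro c hc
      obtain ⟨a, ha, rfl⟩ := Finset.mem_image.1 hc
      rw [norm_smul, hs.1 a ha]
      norm_num
    · intro c hc c' hc' hne
      obtain ⟨a, ha, rfl⟩ := Finset.mem_image.1 hc
      obtain ⟨a', ha', rfl⟩ := Finset.mem_image.1 hc'
      have h := hs.2 a ha a' ha' fun h => hne (by rw [h])
      rw [← smul_sub, norm_smul, Real.norm_of_nonneg zero_le_two]
      linarith
  let R : ℕ → Prop := fun q => ∃ s, Q s ∧ s.card = q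
  have hR0 : R 0 := ⟨∅, by simp [Q], rfl⟩
  obtain ⟨s, hs, hcard⟩ := Nat.findGreatest_spec (P := R) (Nat.zero_le (5 ^ Module.finrank ℝ E)) hR0
  refine ⟨s, hQ s hs, hs.1, fun x hx => ?_⟩
  by_contra! hfar
  have hxs : x ∉ s := fun h => by
    have := hfar x h
    simp at this
    linarith
  have hins : Q (insert x s) := by
    refine ⟨fun c hc => ?_, fun c hc c' hc' hne => ?_⟩
    · rcases Finset.mem_insert.1 hc with rfl | hc
      · exact hx
      · exact hs.1 c hc
    · rcases Finset.mem_insert.1 hc with rfl | hc1 <;> rcases Finset.mem_insert.1 hc' with rfl | hc2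
      · exact absurd rfl hne
      · exact (hfar c' hc2).le
      · rw [norm_sub_rev]
        exact (hfar c hc1).le
      · exact hs.2 c hc1 c' hc2 hne
  have hle := Nat.le_findGreatest (P := R) (hQ _ hins) ⟨_, hins, rfl⟩
  rw [Finset.card_insert_of_notMem hxs, hcard] at hle
  omega

end Net

section Operator

variable {E : Type*} [NormedAddCommGroup E] [InnerProductSpace ℝ E]

/-- If the quadratic form of a symmetric operator is bounded by `t` on a `1/2`-net of the unit
sphere, then the operator norm is at most `32 t`. For unit vectors `x`, `u` with `‖x - u‖ ≤ 1/2` the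
values of the form differ by `⟨T (x - u), x + u⟩`, and `‖x - u‖ ‖x + u‖ ≤ √(15/16) ≤ 31/32`. -/
lemma norm_le_of_net {T : E →L[ℝ] E} (hT : (T : E →ₗ[ℝ] E).IsSymmetric) {N : Finset E}
    (hN : ∀ u ∈ N, ‖u‖ = 1) (hcov : ∀ x : E, ‖x‖ = 1 → ∃ u ∈ N, ‖x - u‖ ≤ 1 / 2) {t : ℝ}
    (ht : 0 ≤ t) (h : ∀ u ∈ N, |inner ℝ (T u) u| ≤ t) : ‖T‖ ≤ 32 * t := by
  have hunit : ∀ x : E, ‖x‖ = 1 → |inner ℝ (T x) x| ≤ t + 31 / 32 * ‖T‖ := fun x hx => by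
    obtain ⟨u, hu, hxu⟩ := hcov x hx
    have hsym : inner ℝ (T x) u = inner ℝ (T u) x := by
      rw [real_inner_comm]
      exact (hT u x).symm
    have hdiff : inner ℝ (T x) x = inner ℝ (T u) u + inner ℝ (T (x - u)) (x + u) := by
      rw [map_sub, inner_sub_left, inner_add_right, inner_add_right, hsym]
      ring
    have hpar := parallelogram_law_with_norm ℝ x u
    rw [hx, hN u hu] at hpar
    have hprod : ‖x - u‖ * ‖x + u‖ ≤ 31 / 32 := by
      refine le_of_sq_le_sq ?_ (by norm_num)
      have h0 := norm_nonneg (x - u)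
      have h1 : ‖x - u‖ * ‖x - u‖ ≤ 1 / 4 := by nlinarith
      rw [mul_pow]
      nlinarith [mul_self_nonneg ‖x - u‖]
    have h2 : |inner ℝ (T (x - u)) (x + u)| ≤ 31 / 32 * ‖T‖ := by
      calc |inner ℝ (T (x - u)) (x + u)| ≤ ‖T (x - u)‖ * ‖x + u‖ := abs_real_inner_le_norm _ _
        _ ≤ ‖T‖ * ‖x - u‖ * ‖x + u‖ := by
          gcongr
          exact T.le_opNorm _
        _ = ‖T‖ * (‖x - u‖ * ‖x + u‖) := by ring
        _ ≤ ‖T‖ * (31 / 32) := by gcongr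
        _ = _ := by ring
    rw [hdiff]
    exact (abs_add_le _ _).trans (add_le_add (h u hu) h2)
  have hle : ‖T‖ ≤ t + 31 / 32 * ‖T‖ := by
    conv_lhs => rw [T.norm_eq_iSup_rayleighQuotient hT]
    refine ciSup_le fun x => ?_
    by_cases hx : x = 0
    · simp only [hx, ContinuousLinearMap.rayleighQuotient, norm_zero]
      simp
      positivity
    · have hx' : ‖x‖ ≠ 0 := norm_ne_zero_iff.2 hx
      have := hunit (‖x‖⁻¹ • x) (norm_smul_inv_norm hx)
      rw [map_smul, inner_smul_left, inner_smul_right] at this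
      refine le_trans (le_of_eq ?_) this
      rw [ContinuousLinearMap.rayleighQuotient, ContinuousLinearMap.reApplyInnerSelf_apply]
      congr 1
      simp only [RCLike.re_to_real, map_inv₀, conj_trivial]
      field_simp
  linarith

lemma sub_mul_norm_le_of_norm_sub_le {S T : E →L[ℝ] E} {s t : ℝ}
    (hS : ∀ u, s * ‖u‖ ≤ ‖S u‖) (h : ‖T - S‖ ≤ t) (u : E) : (s - t) * ‖u‖ ≤ ‖T u‖ := by
  have h1 : ‖(T - S) u‖ ≤ t * ‖u‖ := (T - S).le_of_opNorm_le h u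
  have h2 : ‖S u‖ ≤ ‖T u‖ + ‖(T - S) u‖ := by
    have : S u = T u - (T - S) u := by simp
    rw [this]
    exact norm_sub_le _ _
  linarith [hS u]

lemma isUnit_of_mul_norm_le [FiniteDimensional ℝ E] {T : E →L[ℝ] E} {s : ℝ} (hs : 0 < s)
    (h : ∀ u, s * ‖u‖ ≤ ‖T u‖) : IsUnit T := by
  have := FiniteDimensional.complete ℝ E
  rw [ContinuousLinearMap.isUnit_iff_bijective]
  have hinj : Function.Injective (T : E →ₗ[ℝ] E) := by
    rw [← LinearMap.ker_eq_bot, LinearMap.ker_eq_bot']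
    intro u hu
    have := h u
    rw [show T u = 0 from hu, norm_zero] at this
    exact norm_le_zero_iff.1 (by nlinarith)
  exact ⟨hinj, LinearMap.injective_iff_surjective.1 hinj⟩

end Operator

/-- The smallest singular value bounds a matrix from below. -/
lemma sigmaMin_mul_norm_le {d : ℕ} (A : Matrix (Fin d) (Fin d) ℝ) (u : EuclideanSpace ℝ (Fin d)) :
    sigmaMin A * ‖u‖ ≤ ‖Matrix.toEuclideanCLM (𝕜 := ℝ) A u‖ := by
  set T := Matrix.toEuclideanLin A with hTdef
  have hTu : Matrix.toEuclideanCLM (𝕜 := ℝ) A u = T u := rfl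
  rw [hTu]
  refine le_of_sq_le_sq ?_ (norm_nonneg _)
  have hd : Module.finrank ℝ (EuclideanSpace ℝ (Fin d)) = d := finrank_euclideanSpace_fin
  have hS := T.isSymmetric_adjoint_comp_self
  set e := hS.eigenvectorBasis hd with he
  have h1 : ‖T u‖ ^ 2 = ∑ i, hS.eigenvalues hd i * (e.repr u i) ^ 2 := by
    rw [← real_inner_self_eq_norm_sq, ← LinearMap.adjoint_inner_right, ← e.sum_inner_mul_inner]
    refine Finset.sum_congr rfl fun i _ => ?_
    have h2 : inner ℝ (e i) (T.adjoint (T u)) = hS.eigenvalues hd i * e.repr u i := by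
      have := hS.eigenvectorBasis_apply_self_apply hd u i
      rw [← he] at this
      rw [← e.repr_apply_apply]
      exact this
    rw [h2, real_inner_comm, ← e.repr_apply_apply]
    ring
  have h3 : ‖u‖ ^ 2 = ∑ i, (e.repr u i) ^ 2 := by
    rw [← e.repr.norm_map u, EuclideanSpace.norm_sq_eq]
    simp
  rw [mul_pow, h1, h3, Finset.mul_sum]
  refine Finset.sum_le_sum fun i _ => mul_le_mul_of_nonneg_right ?_ (sq_nonneg _)
  rw [← T.sq_singularValues_fin hd i]
  exact pow_le_pow_left₀ (T.singularValues_nonneg _)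
    (T.singularValues_antitone (by have := i.2; omega)) 2

/-! ### The normal equations of the event-level loss -/

section Deterministic

variable {n m d : ℕ}

/-- The unnormalised sample covariance operator `∑ᵢ xᵢ xᵢᵀ`. -/
noncomputable def gramOp (X : Fin n → EuclideanSpace ℝ (Fin d)) :
    EuclideanSpace ℝ (Fin d) →L[ℝ] EuclideanSpace ℝ (Fin d) :=
  ∑ i, InnerProductSpace.rankOne ℝ (X i) (X i)

/-- The off-diagonal operator `∑ xᵢ xⱼᵀ`, summed over the ordered pairs of distinct samples that lie
in a common bag. -/
noncomputable def bagOp (b : Fin n → Fin m) (X : Fin n → EuclideanSpace ℝ (Fin d)) :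
    EuclideanSpace ℝ (Fin d) →L[ℝ] EuclideanSpace ℝ (Fin d) :=
  ∑ i, ∑ j, if i ≠ j ∧ b i = b j then InnerProductSpace.rankOne ℝ (X i) (X j) else 0

/-- The mean of `bagOp` over a random assignment of bags with weights `p`. -/
noncomputable def meanBagOp (p : (Fin n → Fin m) → ℝ) (X : Fin n → EuclideanSpace ℝ (Fin d)) :
    EuclideanSpace ℝ (Fin d) →L[ℝ] EuclideanSpace ℝ (Fin d) :=
  ∑ b, p b • bagOp b X

/-- The mean, for bags of size `k`, of the samples in the bag of the sample `j`. -/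
noncomputable def bagAvg (k : ℕ) (b : Fin n → Fin m) (X : Fin n → EuclideanSpace ℝ (Fin d))
    (j : Fin n) : EuclideanSpace ℝ (Fin d) :=
  (1 / k : ℝ) • ∑ i, if b i = b j then X i else 0

/-- The noiseless part of the right-hand side of the normal equations for `θ̂ - θ⋆`. -/
noncomputable def biasVec (k : ℕ) (b : Fin n → Fin m) (X : Fin n → EuclideanSpace ℝ (Fin d))
    (θs : EuclideanSpace ℝ (Fin d)) : EuclideanSpace ℝ (Fin d) :=
  (1 / k : ℝ) • bagOp b X θs - (1 - 1 / k : ℝ) • gramOp X θs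

lemma gramOp_apply (X : Fin n → EuclideanSpace ℝ (Fin d)) (u : EuclideanSpace ℝ (Fin d)) :
    gramOp X u = ∑ i, inner ℝ (X i) u • X i := by
  simp [gramOp]

lemma bagOp_apply (b : Fin n → Fin m) (X : Fin n → EuclideanSpace ℝ (Fin d))
    (u : EuclideanSpace ℝ (Fin d)) :
    bagOp b X u = ∑ i, ∑ j, if i ≠ j ∧ b i = b j then inner ℝ (X j) u • X i else 0 := by
  simp only [bagOp, sum_apply]
  refine Finset.sum_congr rfl fun i _ => Finset.sum_congr rfl fun j _ => ?_
  split_ifs <;> simp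

lemma meanBagOp_apply (p : (Fin n → Fin m) → ℝ) (X : Fin n → EuclideanSpace ℝ (Fin d))
    (u : EuclideanSpace ℝ (Fin d)) : meanBagOp p X u = ∑ b, p b • bagOp b X u := by
  simp [meanBagOp]

/-- Stationarity of the event-level loss at a minimizer. -/
lemma sum_residual_smul_eq_zero (hn : 0 < n) {b : Fin n → Fin m}
    {X : Fin n → EuclideanSpace ℝ (Fin d)} {y : Fin n → ℝ} {θ : EuclideanSpace ℝ (Fin d)}
    (h : IsMinOn (eventLoss b X y) Set.univ θ) :
    ∑ i, (bagMean b y (b i) - inner ℝ (X i) θ) • X i = 0 := by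
  have hloss : ∀ θ', eventLoss b X y θ' =
      1 / (n : ℝ) * ∑ i, (bagMean b y (b i) - inner ℝ (X i) θ') ^ 2 := fun θ' => by
    unfold eventLoss
    rw [← Finset.sum_fiberwise Finset.univ b]
    congr 1
    refine Finset.sum_congr rfl fun l _ => Finset.sum_congr rfl fun i hi => ?_
    rw [(Finset.mem_filter.1 hi).2]
  set r : Fin n → ℝ := fun i => bagMean b y (b i) - inner ℝ (X i) θ with hr
  set g := ∑ i, r i • X i with hg
  set q := ∑ i, inner ℝ (X i) g ^ 2 with hq
  have hq0 : 0 ≤ q := Finset.sum_nonneg fun i _ => sq_nonneg _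
  have hgg : ∑ i, r i * inner ℝ (X i) g = ‖g‖ ^ 2 := by
    rw [← real_inner_self_eq_norm_sq]
    conv_rhs => rw [hg, sum_inner]
    exact Finset.sum_congr rfl fun i _ => (real_inner_smul_left _ _ _).symm
  have hstep : ∀ s : ℝ, 0 ≤ -2 * s * ‖g‖ ^ 2 + s ^ 2 * q := fun s => by
    have hmin := h (Set.mem_univ (θ + s • g))
    simp only [Set.mem_ofPred_eq] at hmin
    rw [hloss, hloss] at hmin
    have hle := le_of_mul_le_mul_left hmin (by positivity)
    have hexp : ∑ i, (bagMean b y (b i) - inner ℝ (X i) (θ + s • g)) ^ 2 =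
        ∑ i, r i ^ 2 + (-2 * s * ‖g‖ ^ 2 + s ^ 2 * q) := by
      rw [← hgg, hq, Finset.mul_sum, Finset.mul_sum, ← Finset.sum_add_distrib,
        ← Finset.sum_add_distrib]
      refine Finset.sum_congr rfl fun i _ => ?_
      rw [inner_add_right, real_inner_smul_right]
      ring
    rw [hexp] at hle
    linarith
  have hs := hstep (‖g‖ ^ 2 / (q + 1))
  have h1 : -2 * (‖g‖ ^ 2 / (q + 1)) * ‖g‖ ^ 2 + (‖g‖ ^ 2 / (q + 1)) ^ 2 * q =
      -((‖g‖ ^ 2 / (q + 1)) ^ 2 * (q + 2)) := by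
    field_simp
    ring
  rw [h1] at hs
  have h2 : (‖g‖ ^ 2 / (q + 1)) ^ 2 = 0 := by
    nlinarith [sq_nonneg (‖g‖ ^ 2 / (q + 1))]
  have h3 : ‖g‖ ^ 2 / (q + 1) = 0 := by simpa using h2
  rcases div_eq_zero_iff.1 h3 with h4 | h4
  · simpa using h4
  · linarith

lemma sum_ite_bag_eq {b : Fin n → Fin m} {M : Type*} [AddCommMonoid M] (f : Fin n → Fin n → M) :
    ∑ i, ∑ j, (if b i = b j then f i j else 0) =
      ∑ i, f i i + ∑ i, ∑ j, if i ≠ j ∧ b i = b j then f i j else 0 := by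
  rw [← Finset.sum_add_distrib]
  refine Finset.sum_congr rfl fun i _ => ?_
  rw [← Finset.sum_erase_add _ _ (Finset.mem_univ i), if_pos rfl, add_comm]
  congr 1
  rw [← Finset.sum_erase_add (f := fun j => if i ≠ j ∧ b i = b j then f i j else 0) _
    (Finset.mem_univ i)]
  simp only [ne_eq, not_true_eq_false, false_and, if_false, add_zero]
  refine Finset.sum_congr rfl fun j hj => ?_
  have : i ≠ j := (Finset.ne_of_mem_erase hj).symm
  simp [this]

/-- The estimation error of a minimizer solves a linear system whose right-hand side is affine in
the noise. -/
lemma gramOp_sub_eq (hn : 0 < n) {k : ℕ} {b : Fin n → Fin m}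
    (hb : ∀ l, (bag b l).card = k) {X : Fin n → EuclideanSpace ℝ (Fin d)} {e : Fin n → ℝ}
    {θ θs : EuclideanSpace ℝ (Fin d)}
    (h : IsMinOn (eventLoss b X fun i => inner ℝ (X i) θs + e i) Set.univ θ) :
    gramOp X (θ - θs) = biasVec k b X θs + ∑ j, e j • bagAvg k b X j := by
  have h0 := sum_residual_smul_eq_zero hn h
  simp_rw [sub_smul, Finset.sum_sub_distrib] at h0
  rw [← gramOp_apply, sub_eq_zero] at h0
  rw [map_sub, ← h0]
  have hmean : ∀ i, bagMean b (fun i => inner ℝ (X i) θs + e i) (b i) • X i =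
      (1 / k : ℝ) • ∑ j, (if b i = b j then inner ℝ (X j) θs • X i else 0) +
        (1 / k : ℝ) • ∑ j, (if b i = b j then e j • X i else 0) := fun i => by
    rw [bagMean, hb, bag, Finset.sum_filter, ← smul_add, ← Finset.sum_add_distrib, div_eq_inv_mul,
      one_div, mul_smul, Finset.sum_smul]
    congr 1
    refine Finset.sum_congr rfl fun j _ => ?_
    by_cases hij : b i = b j
    · simp [hij, add_smul]
    · simp [hij, Ne.symm hij]
  simp_rw [hmean]
  rw [Finset.sum_add_distrib, ← Finset.smul_sum, sum_ite_bag_eq, ← gramOp_apply, ← bagOp_apply,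
    biasVec]
  have hz : ∑ j, e j • bagAvg k b X j =
      ∑ i, (1 / k : ℝ) • ∑ j, (if b i = b j then e j • X i else 0) := by
    simp_rw [bagAvg, ← Finset.smul_sum, smul_comm (_ : ℝ) (1 / k : ℝ), ← Finset.smul_sum,
      Finset.smul_sum (r := (e _)), smul_ite, smul_zero]
    rw [Finset.sum_comm]
  rw [hz]
  module

/-- The variance term: the squared norms of the bag means add up to `1/k` times the sum of the
squared norms of the samples and of the trace of `bagOp`, which is `bagChaos`. -/
lemma sum_norm_bagAvg_sq {k : ℕ} (hk : 0 < k) {b : Fin n → Fin m}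
    (hb : ∀ l, (bag b l).card = k) (X : Fin n → EuclideanSpace ℝ (Fin d)) :
    ∑ j, ‖bagAvg k b X j‖ ^ 2 =
      (1 / k : ℝ) * (∑ i, ‖X i‖ ^ 2 + bagChaos b fun i a => X i a) := by
  have hinner : ∀ x y : EuclideanSpace ℝ (Fin d), ∑ a, x a * y a = inner ℝ x y := fun x y => by
    simp [PiLp.inner_apply, mul_comm]
  have hchaos : ∑ i, ‖X i‖ ^ 2 + bagChaos b (fun i a => X i a) =
      ∑ i, ∑ j, if b i = b j then inner ℝ (X i) (X j) else 0 := by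
    rw [sum_ite_bag_eq, bagChaos]
    simp_rw [hinner, real_inner_self_eq_norm_sq]
  -- Each bag mean is constant on its bag, so its square norm is counted `k` times.
  have hsq : ∀ j, ‖bagAvg k b X j‖ ^ 2 = (1 / k : ℝ) ^ 2 *
      ∑ i, ∑ i', if b i = b i' then (if b i = b j then inner ℝ (X i) (X i') else 0) else 0 := by
    intro j
    rw [bagAvg, norm_smul, mul_pow, Real.norm_of_nonneg (by positivity),
      ← real_inner_self_eq_norm_sq, sum_inner]
    congr 1
    refine Finset.sum_congr rfl fun i _ => ?_
    rw [inner_sum]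
    refine Finset.sum_congr rfl fun i' _ => ?_
    by_cases h1 : b i = b j
    · by_cases h2 : b i' = b j
      · simp [h1, h2]
      · simp [h1, h2, Ne.symm h2]
    · simp [h1]
  rw [hchaos]
  simp_rw [hsq]
  rw [← Finset.mul_sum, Finset.sum_comm]
  have hcard : ∀ i, ∑ j, (if b i = b j then (1 : ℝ) else 0) = k := fun i => by
    rw [← hb (b i), bag, Finset.sum_boole]
    simp_rw [eq_comm]
  have : ∀ i, ∑ j, ∑ i', (if b i = b i' then
      (if b i = b j then inner ℝ (X i) (X i') else 0) else 0) =
      k * ∑ i', if b i = b i' then inner ℝ (X i) (X i') else 0 := fun i => by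
    rw [← hcard i, Finset.sum_mul]
    refine Finset.sum_congr rfl fun j _ => ?_
    by_cases h : b i = b j <;> simp [h]
  simp_rw [this]
  rw [← Finset.mul_sum]
  field_simp

lemma norm_sum_smul_sq_le {ι E : Type*} [Fintype ι] [NormedAddCommGroup E] [NormedSpace ℝ E]
    (p : ι → ℝ) (v : ι → E) (hp : ∀ i, 0 ≤ p i) (hp1 : ∑ i, p i = 1) :
    ‖∑ i, p i • v i‖ ^ 2 ≤ ∑ i, p i * ‖v i‖ ^ 2 := by
  have := ((convexOn_norm (E := E) convex_univ).pow (fun _ _ => norm_nonneg _) 2).map_sum_le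
    (t := Finset.univ) (p := v) (fun i _ => hp i) hp1 fun _ _ => Set.mem_univ _
  simpa using this

/-- The design-dependent risk, after averaging over the noise and over the bags, of the image of the
right-hand side of the normal equations under a linear map `R`. -/
noncomputable def meanRisk (k : ℕ) (p : (Fin n → Fin m) → ℝ) (σ : ℝ)
    (θs : EuclideanSpace ℝ (Fin d))
    (R : EuclideanSpace ℝ (Fin d) →L[ℝ] EuclideanSpace ℝ (Fin d))
    (X : Fin n → EuclideanSpace ℝ (Fin d)) : ℝ :=
  ∑ b, p b * (‖R (biasVec k b X θs)‖ ^ 2 + σ ^ 2 * ∑ j, ‖R (bagAvg k b X j)‖ ^ 2)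

lemma sum_smul_biasVec (k : ℕ) {p : (Fin n → Fin m) → ℝ} (hp1 : ∑ b, p b = 1)
    (X : Fin n → EuclideanSpace ℝ (Fin d)) (θs : EuclideanSpace ℝ (Fin d)) :
    ∑ b, p b • biasVec k b X θs =
      (1 / k : ℝ) • meanBagOp p X θs - (1 - 1 / k : ℝ) • gramOp X θs := by
  simp_rw [biasVec, smul_sub, Finset.sum_sub_distrib]
  rw [← Finset.sum_smul, hp1, one_smul, meanBagOp_apply, Finset.smul_sum]
  simp_rw [smul_comm (1 / k : ℝ)]

/-- Jensen's inequality over the bags for the bias, and the identity `sum_norm_bagAvg_sq` for the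
variance. -/
lemma le_meanRisk {k : ℕ} (hk : 0 < k) {p : (Fin n → Fin m) → ℝ} (hp : ∀ b, 0 ≤ p b)
    (hp1 : ∑ b, p b = 1) (hpb : ∀ b, p b ≠ 0 → ∀ l, (bag b l).card = k) {σ β ρ : ℝ}
    {θs : EuclideanSpace ℝ (Fin d)}
    {R : EuclideanSpace ℝ (Fin d) →L[ℝ] EuclideanSpace ℝ (Fin d)}
    {X : Fin n → EuclideanSpace ℝ (Fin d)} (hβ : 0 ≤ β) (hρ : 0 ≤ ρ)
    (hR : ∀ v, ρ * ‖v‖ ≤ ‖R v‖)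
    (hbias : β ≤ ‖R ((1 / k : ℝ) • meanBagOp p X θs - (1 - 1 / k : ℝ) • gramOp X θs)‖) :
    β ^ 2 + σ ^ 2 * ρ ^ 2 * (1 / k) *
      (∑ i, ‖X i‖ ^ 2 + ∑ b, p b * bagChaos b fun i a => X i a) ≤ meanRisk k p σ θs R X := by
  have h1 : β ^ 2 ≤ ∑ b, p b * ‖R (biasVec k b X θs)‖ ^ 2 := by
    refine (pow_le_pow_left₀ hβ hbias 2).trans ?_
    rw [← sum_smul_biasVec k hp1, map_sum]
    simp_rw [map_smul]
    exact norm_sum_smul_sq_le p _ hp hp1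
  have h2 : σ ^ 2 * ρ ^ 2 * (1 / k) *
      (∑ i, ‖X i‖ ^ 2 + ∑ b, p b * bagChaos b fun i a => X i a) ≤
      ∑ b, p b * (σ ^ 2 * ∑ j, ‖R (bagAvg k b X j)‖ ^ 2) := by
    have h3 : ∑ i, ‖X i‖ ^ 2 + ∑ b, p b * bagChaos b (fun i a => X i a) =
        ∑ b, p b * (∑ i, ‖X i‖ ^ 2 + bagChaos b fun i a => X i a) := by
      simp_rw [mul_add, Finset.sum_add_distrib]
      rw [← Finset.sum_mul, hp1, one_mul]
    rw [h3, Finset.mul_sum]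
    refine Finset.sum_le_sum fun b _ => ?_
    by_cases hb0 : p b = 0
    · simp [hb0]
    have h4 : ∑ j, (ρ * ‖bagAvg k b X j‖) ^ 2 ≤ ∑ j, ‖R (bagAvg k b X j)‖ ^ 2 :=
      Finset.sum_le_sum fun j _ => pow_le_pow_left₀ (by positivity) (hR _) 2
    simp_rw [mul_pow] at h4
    rw [← Finset.mul_sum, sum_norm_bagAvg_sq hk (hpb b hb0)] at h4
    calc _ = p b * (σ ^ 2 * (ρ ^ 2 * (1 / k *
          (∑ i, ‖X i‖ ^ 2 + bagChaos b fun i a => X i a)))) := by ring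
      _ ≤ _ := by
        have := hp b
        gcongr
  refine (add_le_add h1 h2).trans (le_of_eq ?_)
  rw [meanRisk, ← Finset.sum_add_distrib]
  exact Finset.sum_congr rfl fun b _ => (mul_add _ _ _).symm

end Deterministic

/-! ### The conditional risk given the design -/

/-- The second moment of an affine function of white noise. -/
lemma lintegral_norm_add_sum_smul_sq {n : ℕ} {E : Type*} [NormedAddCommGroup E]
    [InnerProductSpace ℝ E] {P : Measure Ω} [IsProbabilityMeasure P] {σ : ℝ}
    {ε : Fin n → Ω → ℝ} (hε : IsWhiteNoise σ ε P) (a : E) (z : Fin n → E) :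
    ∫⁻ ω, ENNReal.ofReal (‖a + ∑ j, ε j ω • z j‖ ^ 2) ∂P =
      ENNReal.ofReal (‖a‖ ^ 2 + σ ^ 2 * ∑ j, ‖z j‖ ^ 2) := by
  have hexp : ∀ ω, ‖a + ∑ j, ε j ω • z j‖ ^ 2 = ‖a‖ ^ 2 + ∑ j, ε j ω * (2 * inner ℝ a (z j)) +
      ∑ i, ∑ j, ε i ω * ε j ω * inner ℝ (z i) (z j) := fun ω => by
    rw [norm_add_sq_real, ← real_inner_self_eq_norm_sq (∑ j, ε j ω • z j), inner_sum, sum_inner,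
      Finset.mul_sum]
    congr 1
    · congr 1
      refine Finset.sum_congr rfl fun j _ => ?_
      rw [real_inner_smul_right]
      ring
    · refine Finset.sum_congr rfl fun i _ => ?_
      rw [inner_sum]
      refine Finset.sum_congr rfl fun j _ => ?_
      rw [real_inner_smul_left, real_inner_smul_right]
      ring
  have hi1 : ∀ j, Integrable (fun ω => ε j ω * (2 * inner ℝ a (z j))) P := fun j =>
    ((hε.memLp j).integrable one_le_two).mul_const _
  have hi2 : ∀ i j, Integrable (fun ω => ε i ω * ε j ω * inner ℝ (z i) (z j)) P := fun i j =>
    ((hε.memLp i).integrable_mul (hε.memLp j)).mul_const _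
  have hI1 : Integrable (fun ω => ‖a‖ ^ 2 + ∑ j, ε j ω * (2 * inner ℝ a (z j))) P :=
    (integrable_const _).add (integrable_finsetSum _ fun j _ => hi1 j)
  have hI2 : Integrable (fun ω => ∑ i, ∑ j, ε i ω * ε j ω * inner ℝ (z i) (z j)) P :=
    integrable_finsetSum _ fun i _ => integrable_finsetSum _ fun j _ => hi2 i j
  have hI : Integrable (fun ω => ‖a + ∑ j, ε j ω • z j‖ ^ 2) P := by
    simp_rw [hexp]
    exact hI1.add hI2
  rw [← ofReal_integral_eq_lintegral_ofReal hI (Filter.Eventually.of_forall fun _ => sq_nonneg _)]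
  congr 1
  simp_rw [hexp]
  rw [integral_add hI1 hI2, integral_add (integrable_const _)
    (integrable_finsetSum _ fun j _ => hi1 j), integral_finsetSum _ fun j _ => hi1 j,
    integral_finsetSum _ fun i _ => integrable_finsetSum _ fun j _ => hi2 i j]
  simp_rw [integral_finsetSum _ fun j _ => hi2 _ j, integral_mul_const, hε.centered,
    hε.covariance]
  simp [Finset.mul_sum]

lemma continuous_rankOne_eval {n d : ℕ} (i j : Fin n) :
    Continuous fun X : Fin n → EuclideanSpace ℝ (Fin d) =>
      InnerProductSpace.rankOne ℝ (X i) (X j) := by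
  refine continuous_clm_apply.2 fun u => ?_
  simp only [InnerProductSpace.rankOne_apply]
  fun_prop

lemma continuous_gramOp {n d : ℕ} :
    Continuous (gramOp : (Fin n → EuclideanSpace ℝ (Fin d)) → _) := by
  unfold gramOp
  exact continuous_finsetSum _ fun i _ => continuous_rankOne_eval i i

lemma continuous_bagOp {n m d : ℕ} (b : Fin n → Fin m) :
    Continuous (bagOp b : (Fin n → EuclideanSpace ℝ (Fin d)) → _) := by
  unfold bagOp
  refine continuous_finsetSum _ fun i _ => continuous_finsetSum _ fun j _ => ?_
  split_ifs
  · exact continuous_rankOne_eval i j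
  · exact continuous_const

lemma continuous_meanBagOp {n m d : ℕ} (p : (Fin n → Fin m) → ℝ) :
    Continuous (meanBagOp p : (Fin n → EuclideanSpace ℝ (Fin d)) → _) := by
  unfold meanBagOp
  refine continuous_finsetSum _ fun b _ => ?_
  have := continuous_bagOp (d := d) b
  fun_prop

lemma continuous_bagAvg {n m d : ℕ} (k : ℕ) (b : Fin n → Fin m) (j : Fin n) :
    Continuous fun X : Fin n → EuclideanSpace ℝ (Fin d) => bagAvg k b X j := by
  have : Continuous fun X : Fin n → EuclideanSpace ℝ (Fin d) =>
      ∑ i, if b i = b j then X i else 0 := by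
    refine continuous_finsetSum _ fun i _ => ?_
    split_ifs
    · exact continuous_apply i
    · exact continuous_const
  unfold bagAvg
  fun_prop

lemma continuous_biasVec {n m d : ℕ} (k : ℕ) (b : Fin n → Fin m)
    (θs : EuclideanSpace ℝ (Fin d)) :
    Continuous fun X : Fin n → EuclideanSpace ℝ (Fin d) => biasVec k b X θs := by
  have h1 := continuous_bagOp (d := d) b
  have h2 := continuous_gramOp (n := n) (d := d)
  unfold biasVec
  fun_prop

lemma measurable_inverse_gramOp {n d : ℕ} :
    Measurable fun X : Fin n → EuclideanSpace ℝ (Fin d) => Ring.inverse (gramOp X) := by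
  classical
  let U : Set (EuclideanSpace ℝ (Fin d) →L[ℝ] EuclideanSpace ℝ (Fin d)) := {T | IsUnit T}
  have hU : MeasurableSet U := Units.isOpen.measurableSet
  have heq : (Ring.inverse : (EuclideanSpace ℝ (Fin d) →L[ℝ] EuclideanSpace ℝ (Fin d)) → _) =
      U.piecewise Ring.inverse fun _ => 0 := by
    funext T
    by_cases hT : T ∈ U
    · rw [Set.piecewise_eq_of_mem _ _ _ hT]
    · rw [Set.piecewise_eq_of_notMem _ _ _ hT, Ring.inverse_non_unit _ hT]
  have hinv : Measurable
      (Ring.inverse : (EuclideanSpace ℝ (Fin d) →L[ℝ] EuclideanSpace ℝ (Fin d)) → _) := by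
    rw [heq]
    refine ContinuousOn.measurable_piecewise ?_ continuousOn_const hU
    rintro _ ⟨T, rfl⟩
    exact (NormedRing.inverse_continuousAt T).continuousWithinAt
  exact hinv.comp continuous_gramOp.measurable

lemma measurable_clm_apply {α E F : Type*} [MeasurableSpace α] [NormedAddCommGroup E]
    [NormedSpace ℝ E] [NormedAddCommGroup F] [NormedSpace ℝ F] [MeasurableSpace E] [BorelSpace E]
    [SecondCountableTopology E] [MeasurableSpace F] [BorelSpace F] {R : α → E →L[ℝ] F} {v : α → E}
    (hR : Measurable R) (hv : Measurable v) : Measurable fun a => R a (v a) := by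
  have : Continuous fun q : (E →L[ℝ] F) × E => q.1 q.2 :=
    continuous_fst.clm_apply continuous_snd
  exact this.measurable.comp (hR.prodMk hv)

/-- A lower bound for the conditional expectation given `Y` on an event in terms of `Y`, from lower
bounds for the integrals over all smaller such events. -/
lemma ae_le_condLExp_of_setLIntegral {α : Type*} [MeasurableSpace α] {P : Measure Ω}
    [IsProbabilityMeasure P] {Y : Ω → α} (hY : Measurable Y) {F : Ω → ENNReal}
    {S : Set α} (hS : MeasurableSet S) {L : ENNReal}
    (h : ∀ T, MeasurableSet T → T ⊆ S → L * P (Y ⁻¹' T) ≤ ∫⁻ ω in Y ⁻¹' T, F ω ∂P) :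
    ∀ᵐ ω ∂P, Y ω ∈ S → L ≤ condLExp (MeasurableSpace.comap Y inferInstance) P F ω := by
  have hm := hY.comap_le
  have hYS : MeasurableSet[MeasurableSpace.comap Y inferInstance] (Y ⁻¹' S) := ⟨S, hS, rfl⟩
  have hind : Measurable[MeasurableSpace.comap Y inferInstance]
      ((Y ⁻¹' S).indicator fun _ => L) := measurable_const.indicator hYS
  have hae : (Y ⁻¹' S).indicator (fun _ => L) ≤ᵐ[P.trim hm]
      condLExp (MeasurableSpace.comap Y inferInstance) P F := by
    refine ae_le_of_forall_setLIntegral_le_of_sigmaFinite hind ?_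
    rintro _ ⟨T, hT, rfl⟩ -
    rw [setLIntegral_condLExp_trim hm P F ⟨T, hT, rfl⟩, setLIntegral_trim hm hind ⟨T, hT, rfl⟩,
      lintegral_indicator_const (hm _ hYS), Measure.restrict_apply (hm _ hYS),
      ← Set.preimage_inter]
    refine (h (S ∩ T) (hS.inter hT) Set.inter_subset_left).trans ?_
    exact lintegral_mono_set (Set.preimage_mono Set.inter_subset_right)
  filter_upwards [ae_of_ae_trim hm hae] with ω hω hS'
  rwa [Set.indicator_of_mem (show ω ∈ Y ⁻¹' S from hS')] at hω

/-- On an event in terms of the design on which the linear map `R` does not increase the norm of the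
image of the error under `gramOp`, the conditional risk is at least any lower bound of
`meanRisk`. -/
lemma ae_le_condRisk {n d m k : ℕ} (hn : 0 < n) {P : Measure Ω} [IsProbabilityMeasure P]
    {θs : EuclideanSpace ℝ (Fin d)} {σ : ℝ} {x : Fin n → Ω → EuclideanSpace ℝ (Fin d)}
    {ε : Fin n → Ω → ℝ} {B : Ω → Fin n → Fin m} {θh : Ω → EuclideanSpace ℝ (Fin d)}
    (hx : ∀ i, Measurable (x i)) (hε : IsWhiteNoise σ ε P)
    (hxε : IndepFun (design x) (fun ω i => ε i ω) P) (hB : Measurable B)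
    (hBk : ∀ ω l, (bag (B ω) l).card = k)
    (hBxy : IndepFun B (fun ω => (design x ω, response θs x ε ω)) P)
    (hmin : ∀ᵐ ω ∂P, IsMinOn (eventLoss (B ω) (design x ω) (response θs x ε ω)) Set.univ (θh ω))
    {R : (Fin n → EuclideanSpace ℝ (Fin d)) →
      EuclideanSpace ℝ (Fin d) →L[ℝ] EuclideanSpace ℝ (Fin d)} (hR : Measurable R)
    {S : Set (Fin n → EuclideanSpace ℝ (Fin d))} (hS : MeasurableSet S)
    (hRS : ∀ X ∈ S, ∀ v, ‖R X (gramOp X v)‖ ≤ ‖v‖) {L : ℝ}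
    (hL : ∀ X ∈ S, L ≤ meanRisk k (fun b => P.real (B ⁻¹' {b})) σ θs (R X) X) :
    ∀ᵐ ω ∂P, design x ω ∈ S → ENNReal.ofReal L ≤ condRisk P θh θs x ω := by
  have hX : Measurable (design x) := measurable_pi_lambda _ hx
  have hεm : Measurable fun ω i => ε i ω := measurable_pi_lambda _ hε.measurable
  refine ae_le_condLExp_of_setLIntegral hX hS fun T hT hTS => ?_
  let Φ : (Fin n → Fin m) → (Fin n → EuclideanSpace ℝ (Fin d)) → (Fin n → ℝ) → ENNReal :=
    fun b X e => T.indicator (fun X => ENNReal.ofReal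
      (‖R X (biasVec k b X θs) + ∑ j, e j • R X (bagAvg k b X j)‖ ^ 2)) X
  have hΦ : ∀ b, Measurable (Function.uncurry (Φ b)) := fun b => by
    have h1 : Measurable fun q : (Fin n → EuclideanSpace ℝ (Fin d)) × (Fin n → ℝ) =>
        ENNReal.ofReal (‖R q.1 (biasVec k b q.1 θs) +
          ∑ j, q.2 j • R q.1 (bagAvg k b q.1 j)‖ ^ 2) := by
      have h2 : Measurable fun q : (Fin n → EuclideanSpace ℝ (Fin d)) × (Fin n → ℝ) => R q.1 :=
        hR.comp measurable_fst
      have h3 := measurable_clm_apply h2 ((continuous_biasVec k b θs).measurable.comp measurable_fst)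
      have h4 : ∀ j, Measurable fun q : (Fin n → EuclideanSpace ℝ (Fin d)) × (Fin n → ℝ) =>
          q.2 j • R q.1 (bagAvg k b q.1 j) := fun j =>
        (Measurable.comp (measurable_pi_apply j) measurable_snd :
          Measurable fun q : (Fin n → EuclideanSpace ℝ (Fin d)) × (Fin n → ℝ) => q.2 j).smul
          (measurable_clm_apply h2 ((continuous_bagAvg k b j).measurable.comp measurable_fst))
      exact ((h3.add (Finset.measurable_sum _ fun j _ => h4 j)).norm.pow_const 2).ennreal_ofReal
    have h5 : Function.uncurry (Φ b) = (Prod.fst ⁻¹' T).indicator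
        fun q : (Fin n → EuclideanSpace ℝ (Fin d)) × (Fin n → ℝ) =>
          ENNReal.ofReal (‖R q.1 (biasVec k b q.1 θs) +
          ∑ j, q.2 j • R q.1 (bagAvg k b q.1 j)‖ ^ 2) := by
      funext q
      obtain ⟨X, e⟩ := q
      by_cases hq : X ∈ T <;> simp [Function.uncurry, Φ, Set.indicator, hq]
    rw [h5]
    exact h1.indicator (measurable_fst hT)
  -- The bags are independent of the pair formed by the design and the noise.
  have hBε : IndepFun B (fun ω => (design x ω, fun i => ε i ω)) P := by
    have hg : Measurable fun q : (Fin n → EuclideanSpace ℝ (Fin d)) × (Fin n → ℝ) =>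
        (q.1, fun i => q.2 i - inner ℝ (q.1 i) θs) := by fun_prop
    have := hBxy.comp (φ := id) measurable_id hg
    have hcomp : (fun q : (Fin n → EuclideanSpace ℝ (Fin d)) × (Fin n → ℝ) =>
        (q.1, fun i => q.2 i - inner ℝ (q.1 i) θs)) ∘ (fun ω => (design x ω, response θs x ε ω)) =
        fun ω => (design x ω, fun i => ε i ω) := by
      funext ω
      refine Prod.ext rfl (funext fun i => ?_)
      simp [response, design]
    rwa [hcomp] at this
  have hcell : ∀ b, ∫⁻ ω, (B ⁻¹' {b}).indicator 1 ω * Φ b (design x ω) (fun i => ε i ω) ∂P =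
      P (B ⁻¹' {b}) * ∫⁻ ω, Φ b (design x ω) (fun i => ε i ω) ∂P := fun b => by
    have hind : Measurable (({b} : Set (Fin n → Fin m)).indicator (1 : (Fin n → Fin m) → ENNReal)) :=
      measurable_one.indicator (measurableSet_singleton b)
    have := lintegral_mul_eq_lintegral_mul_lintegral_of_indepFun (μ := P)
      (f := fun ω => ({b} : Set (Fin n → Fin m)).indicator 1 (B ω))
      (g := fun ω => Function.uncurry (Φ b) (design x ω, fun i => ε i ω)) (hind.comp hB)
      ((hΦ b).comp (hX.prodMk hεm)) (hBε.comp hind (hΦ b))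
    simp only [Pi.mul_apply] at this
    have h1 : ∫⁻ ω, ({b} : Set (Fin n → Fin m)).indicator 1 (B ω) ∂P = P (B ⁻¹' {b}) := by
      rw [← lintegral_indicator_one (hB (measurableSet_singleton b))]
      rfl
    rw [h1] at this
    exact this
  have hnoise : ∀ b, ∫⁻ ω, Φ b (design x ω) (fun i => ε i ω) ∂P =
      ∫⁻ ω in design x ⁻¹' T, ENNReal.ofReal (‖R (design x ω) (biasVec k b (design x ω) θs)‖ ^ 2 +
        σ ^ 2 * ∑ j, ‖R (design x ω) (bagAvg k b (design x ω) j)‖ ^ 2) ∂P := fun b => by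
    rw [hxε.lintegral_comp_pair hX hεm (hΦ b), ← lintegral_indicator (hX hT)]
    refine lintegral_congr fun ω => ?_
    by_cases hω : design x ω ∈ T
    · simp only [Φ, Set.indicator_of_mem hω,
        Set.indicator_of_mem (show ω ∈ design x ⁻¹' T from hω)]
      exact lintegral_norm_add_sum_smul_sq hε _ _
    · simp only [Φ, Set.indicator_of_notMem hω,
        Set.indicator_of_notMem (show ω ∉ design x ⁻¹' T from hω), lintegral_zero]
  have hlower : ∀ᵐ ω ∂P, ∑ b, (B ⁻¹' {b}).indicator 1 ω * Φ b (design x ω) (fun i => ε i ω) ≤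
      (design x ⁻¹' T).indicator (fun ω => ENNReal.ofReal (‖θh ω - θs‖ ^ 2)) ω := by
    filter_upwards [hmin] with ω hω
    rw [Finset.sum_eq_single (B ω)]
    · by_cases hT' : design x ω ∈ T
      · simp only [Φ, Set.indicator_of_mem hT',
          Set.indicator_of_mem (show ω ∈ design x ⁻¹' T from hT'),
          Set.indicator_of_mem (show ω ∈ B ⁻¹' {B ω} from rfl), Pi.one_apply, one_mul]
        refine ENNReal.ofReal_le_ofReal (pow_le_pow_left₀ (norm_nonneg _) ?_ 2)
        refine le_trans (le_of_eq ?_) (hRS _ (hTS hT') (θh ω - θs))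
        rw [gramOp_sub_eq hn (hBk ω) (X := design x ω) (e := fun i => ε i ω) hω, map_add, map_sum]
        simp_rw [map_smul]
      · simp [Φ, Set.indicator_of_notMem hT',
          Set.indicator_of_notMem (show ω ∉ design x ⁻¹' T from hT')]
    · intro b _ hb
      rw [Set.indicator_of_notMem (show ω ∉ B ⁻¹' {b} from fun h => hb h.symm), zero_mul]
    · simp
  calc ENNReal.ofReal L * P (design x ⁻¹' T)
      = ∫⁻ _ in design x ⁻¹' T, ENNReal.ofReal L ∂P := by rw [setLIntegral_const]
    _ ≤ ∫⁻ ω in design x ⁻¹' T, ∑ b, P (B ⁻¹' {b}) *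
          ENNReal.ofReal (‖R (design x ω) (biasVec k b (design x ω) θs)‖ ^ 2 +
            σ ^ 2 * ∑ j, ‖R (design x ω) (bagAvg k b (design x ω) j)‖ ^ 2) ∂P := by
        refine setLIntegral_mono' (hX hT) fun ω hω => ?_
        refine (ENNReal.ofReal_le_ofReal (hL _ (hTS hω))).trans (le_of_eq ?_)
        rw [meanRisk, ENNReal.ofReal_sum_of_nonneg fun b _ => by positivity]
        refine Finset.sum_congr rfl fun b _ => ?_
        rw [ENNReal.ofReal_mul measureReal_nonneg, ofReal_measureReal]
    _ = ∑ b, P (B ⁻¹' {b}) * ∫⁻ ω, Φ b (design x ω) (fun i => ε i ω) ∂P := by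
        have hm : ∀ b : Fin n → Fin m, Measurable fun ω =>
            ENNReal.ofReal (‖R (design x ω) (biasVec k b (design x ω) θs)‖ ^ 2 +
              σ ^ 2 * ∑ j, ‖R (design x ω) (bagAvg k b (design x ω) j)‖ ^ 2) := fun b => by
          have h2 : Measurable fun ω => R (design x ω) := hR.comp hX
          have h3 : Measurable fun ω => R (design x ω) (biasVec k b (design x ω) θs) :=
            measurable_clm_apply h2 ((continuous_biasVec k b θs).measurable.comp hX)
          have h4 : ∀ j, Measurable fun ω => R (design x ω) (bagAvg k b (design x ω) j) :=
            fun j => measurable_clm_apply h2 ((continuous_bagAvg k b j).measurable.comp hX)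
          exact ((h3.norm.pow_const 2).add ((Finset.measurable_sum _ fun j _ =>
            (h4 j).norm.pow_const 2).const_mul _)).ennreal_ofReal
        rw [lintegral_finsetSum _ fun b _ => (hm b).const_mul _]
        refine Finset.sum_congr rfl fun b _ => ?_
        rw [lintegral_const_mul _ (hm b), hnoise]
    _ = ∫⁻ ω, ∑ b, (B ⁻¹' {b}).indicator 1 ω * Φ b (design x ω) (fun i => ε i ω) ∂P := by
        have hm : ∀ b : Fin n → Fin m, Measurable fun ω =>
            (B ⁻¹' {b}).indicator 1 ω * Φ b (design x ω) (fun i => ε i ω) := fun b =>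
          (measurable_one.indicator (hB (measurableSet_singleton b))).mul
            ((hΦ b).comp (hX.prodMk hεm))
        rw [lintegral_finsetSum _ fun b _ => hm b]
        exact Finset.sum_congr rfl fun b _ => (hcell b).symm
    _ ≤ ∫⁻ ω in design x ⁻¹' T, ENNReal.ofReal (‖θh ω - θs‖ ^ 2) ∂P := by
        rw [← lintegral_indicator (hX hT)]
        exact lintegral_mono_ae hlower

/-! ### Concentration for a subgaussian design -/

lemma card_eq_mul_of_bag {n m k : ℕ} {b : Fin n → Fin m} (hb : ∀ l, (bag b l).card = k) :
    m * k = n := by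
  have := Finset.card_eq_sum_card_fiberwise (f := b) (s := Finset.univ) (t := Finset.univ)
    fun _ _ => Finset.mem_coe.2 (Finset.mem_univ _)
  rw [Finset.card_univ, Fintype.card_fin] at this
  have hsum : ∑ l, (bag b l).card = m * k := by simp [hb]
  exact (this.trans hsum).symm

section Design

variable {n d : ℕ} {κ : ℝ} {A : Matrix (Fin d) (Fin d) ℝ}
  {x : Fin n → Ω → EuclideanSpace ℝ (Fin d)} {P : Measure Ω}

lemma IsSubgaussianDesign.lintegral_eexp_inner_sq (h : IsSubgaussianDesign κ A x P) (i : Fin n)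
    {u : EuclideanSpace ℝ (Fin d)} (hu : ‖u‖ = 1) :
    ∫⁻ ω, eexp ((inner ℝ (x i ω) u) ^ 2 / κ ^ 2) ∂P ≤ 2 :=
  h.subgaussian i u hu

lemma IsSubgaussianDesign.measurable_inner (h : IsSubgaussianDesign κ A x P) (i : Fin n)
    (u : EuclideanSpace ℝ (Fin d)) : Measurable fun ω => inner ℝ (x i ω) u :=
  (h.measurable i).inner measurable_const

lemma IsSubgaussianDesign.measurable_apply (h : IsSubgaussianDesign κ A x P) (i : Fin n)
    (a : Fin d) : Measurable fun ω => x i ω a := by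
  have := h.measurable i
  fun_prop

lemma IsSubgaussianDesign.lintegral_eexp_apply_sq (h : IsSubgaussianDesign κ A x P) (i : Fin n)
    (a : Fin d) : ∫⁻ ω, eexp ((x i ω a) ^ 2 / κ ^ 2) ∂P ≤ 2 := by
  have := h.lintegral_eexp_inner_sq i (u := EuclideanSpace.single a (1 : ℝ)) (by simp)
  simpa [EuclideanSpace.inner_single_right] using this

lemma inner_eq_sum_mul (v u : EuclideanSpace ℝ (Fin d)) : inner ℝ v u = ∑ a, u a * v a := by
  simp [PiLp.inner_apply, mul_comm]

variable [IsProbabilityMeasure P]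

lemma IsSubgaussianDesign.memLp_apply (h : IsSubgaussianDesign κ A x P) (hκ : 0 < κ) (i : Fin n)
    (a : Fin d) : MemLp (fun ω => x i ω a) 2 P :=
  memLp_two_of_subgaussian hκ (h.measurable_apply i a) (h.lintegral_eexp_apply_sq i a)

lemma IsSubgaussianDesign.integral_inner (h : IsSubgaussianDesign κ A x P) (hκ : 0 < κ)
    (i : Fin n) (u : EuclideanSpace ℝ (Fin d)) : ∫ ω, inner ℝ (x i ω) u ∂P = 0 := by
  simp_rw [inner_eq_sum_mul]
  rw [integral_finsetSum _ fun a _ =>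
    ((h.memLp_apply hκ i a).integrable one_le_two).const_mul _]
  simp_rw [integral_const_mul, h.centered, mul_zero, Finset.sum_const_zero]

lemma IsSubgaussianDesign.integral_inner_sq (h : IsSubgaussianDesign κ A x P) (hκ : 0 < κ)
    (i : Fin n) (u : EuclideanSpace ℝ (Fin d)) :
    ∫ ω, (inner ℝ (x i ω) u) ^ 2 ∂P =
      inner ℝ (Matrix.toEuclideanCLM (𝕜 := ℝ) A u) u := by
  have hint : ∀ a b, Integrable (fun ω => u a * u b * (x i ω a * x i ω b)) P := fun a b =>
    ((h.memLp_apply hκ i a).integrable_mul (h.memLp_apply hκ i b)).const_mul _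
  have hexp : ∀ ω, (inner ℝ (x i ω) u) ^ 2 =
      ∑ a, ∑ b, u a * u b * (x i ω a * x i ω b) := fun ω => by
    rw [inner_eq_sum_mul, sq, Finset.sum_mul_sum]
    refine Finset.sum_congr rfl fun a _ => Finset.sum_congr rfl fun b _ => ?_
    ring
  simp_rw [hexp]
  rw [integral_finsetSum _ fun a _ => integrable_finsetSum _ fun b _ => hint a b, inner_eq_sum_mul]
  refine Finset.sum_congr rfl fun a _ => ?_
  rw [integral_finsetSum _ fun b _ => hint a b]
  have hA : (Matrix.toEuclideanCLM (𝕜 := ℝ) A u) a = ∑ b, A a b * u b := by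
    rw [Matrix.ofLp_toEuclideanCLM]
    rfl
  rw [hA, Finset.mul_sum]
  refine Finset.sum_congr rfl fun b _ => ?_
  rw [integral_const_mul, h.covariance]
  ring

lemma IsSubgaussianDesign.lintegral_eexp_inner_le (h : IsSubgaussianDesign κ A x P) (hκ : 0 < κ)
    (i : Fin n) (u : EuclideanSpace ℝ (Fin d)) :
    ∫⁻ ω, eexp (inner ℝ (x i ω) u) ∂P ≤ eexp (κ ^ 2 * ‖u‖ ^ 2) := by
  by_cases hu : u = 0
  · simp [hu, eexp_zero]
  have hu' : ‖u‖ ≠ 0 := norm_ne_zero_iff.2 hu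
  have := lintegral_eexp_mul_le hκ (h.measurable_inner i (‖u‖⁻¹ • u))
    (h.lintegral_eexp_inner_sq i (norm_smul_inv_norm hu)) (h.integral_inner hκ i _) ‖u‖
  simp_rw [real_inner_smul_right, mul_inv_cancel_left₀ hu'] at this
  exact this

lemma IsSubgaussianDesign.lintegral_eexp_sum_le (h : IsSubgaussianDesign κ A x P) (hκ : 0 < κ)
    (i : Fin n) (u : Fin d → ℝ) :
    ∫⁻ ω, eexp (∑ a, u a * x i ω a) ∂P ≤ eexp (κ ^ 2 * ∑ a, u a ^ 2) := by
  have := h.lintegral_eexp_inner_le hκ i (WithLp.toLp 2 u)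
  simp_rw [inner_eq_sum_mul] at this
  simpa [EuclideanSpace.norm_sq_eq] using this

/-- Exponential moments of the centered quadratic form of the sample covariance. -/
lemma IsSubgaussianDesign.lintegral_eexp_sum_inner_sq_le (h : IsSubgaussianDesign κ A x P)
    (hκ : 0 < κ) {u : EuclideanSpace ℝ (Fin d)} (hu : ‖u‖ = 1) {l : ℝ}
    (hl : 2 * κ ^ 2 * |l| ≤ 1) :
    ∫⁻ ω, eexp (l * (∑ i, (inner ℝ (x i ω) u) ^ 2 -
      n * inner ℝ (Matrix.toEuclideanCLM (𝕜 := ℝ) A u) u)) ∂P ≤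
      eexp (16 * l ^ 2 * κ ^ 4 * n) := by
  set q := inner ℝ (Matrix.toEuclideanCLM (𝕜 := ℝ) A u) u with hq
  have hm : Measurable fun y : EuclideanSpace ℝ (Fin d) => eexp (l * ((inner ℝ y u) ^ 2 - q)) := by
    refine Measurable.eexp ?_
    exact (((measurable_id.inner measurable_const).pow_const 2).sub_const _).const_mul _
  have hsum : ∀ ω, eexp (l * (∑ i, (inner ℝ (x i ω) u) ^ 2 - n * q)) =
      ∏ i, eexp (l * ((inner ℝ (x i ω) u) ^ 2 - q)) := fun ω => by
    rw [← eexp_sum, ← Finset.mul_sum, Finset.sum_sub_distrib]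
    simp
  rw [lintegral_congr hsum, lintegral_prod_eq_prod_lintegral_of_indepFun Finset.univ
    (fun i ω => eexp (l * ((inner ℝ (x i ω) u) ^ 2 - q))) (h.indep.comp _ fun _ => hm)
    fun i => hm.comp (h.measurable i)]
  have hone : ∀ i, ∫⁻ ω, eexp (l * ((inner ℝ (x i ω) u) ^ 2 - q)) ∂P ≤
      eexp (16 * l ^ 2 * κ ^ 4) := fun i => by
    have h1 := lintegral_eexp_mul_sq_le hκ (h.measurable_inner i u)
      (h.lintegral_eexp_inner_sq i hu) hl
    rw [h.integral_inner_sq hκ i u, ← hq] at h1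
    calc ∫⁻ ω, eexp (l * ((inner ℝ (x i ω) u) ^ 2 - q)) ∂P
        = (∫⁻ ω, eexp (l * (inner ℝ (x i ω) u) ^ 2) ∂P) * eexp (-(l * q)) := by
          rw [← lintegral_mul_const _
            (((h.measurable_inner i u).pow_const 2).const_mul l).eexp]
          refine lintegral_congr fun ω => ?_
          rw [← eexp_add]
          ring_nf
      _ ≤ eexp (l * q + 16 * l ^ 2 * κ ^ 4) * eexp (-(l * q)) := by gcongr
      _ = eexp (16 * l ^ 2 * κ ^ 4) := by
          rw [← eexp_add]
          ring_nf
  refine (Finset.prod_le_prod' fun i _ => hone i).trans (le_of_eq ?_)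
  rw [Finset.prod_const, eexp_pow, Finset.card_univ, Fintype.card_fin]
  ring_nf

lemma exp_neg_le_quadratic {y : ℝ} (hy : 0 ≤ y) : Real.exp (-y) ≤ 1 - y + y ^ 2 / 2 := by
  have h := Real.quadratic_le_exp_of_nonneg hy
  have h1 : Real.exp (-y) * Real.exp y = 1 := by rw [← Real.exp_add]; simp
  have h2 : 0 < 1 - y + y ^ 2 / 2 := by nlinarith [sq_nonneg (y - 1)]
  have h3 : 1 ≤ (1 - y + y ^ 2 / 2) * Real.exp y := by
    nlinarith [sq_nonneg (y ^ 2)]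
  have hpos := Real.exp_pos y
  nlinarith

/-- Exponential moments that control the lower tail of the squared norms of the samples. Since the
squared norms are nonnegative, only their first and second moments enter. -/
lemma IsSubgaussianDesign.lintegral_eexp_neg_sum_norm_sq_le (h : IsSubgaussianDesign κ A x P)
    (hκ : 0 < κ) {l : ℝ} (hl : 0 ≤ l) :
    ∫⁻ ω, eexp (l * (n * A.trace - ∑ i, ‖x i ω‖ ^ 2)) ∂P ≤
      eexp (2 * l ^ 2 * κ ^ 4 * d ^ 2 * n) := by
  have hns : ∀ i ω, ‖x i ω‖ ^ 2 = ∑ a, (x i ω a) ^ 2 := fun i ω => by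
    rw [EuclideanSpace.norm_sq_eq]
    simp
  have hsq : ∀ i a, Integrable (fun ω => (x i ω a) ^ 2) P := fun i a =>
    (h.memLp_apply hκ i a).integrable_sq
  have hfour : ∀ i a, Integrable (fun ω => (x i ω a) ^ 4) P := fun i a =>
    integrable_pow_four hκ (h.measurable_apply i a) (h.lintegral_eexp_apply_sq i a)
  have hnm : ∀ i, Measurable fun ω => ‖x i ω‖ ^ 2 := fun i => (h.measurable i).norm.pow_const 2
  have hone : ∀ i, ∫⁻ ω, eexp (-l * ‖x i ω‖ ^ 2) ∂P ≤
      eexp (-l * A.trace + 2 * l ^ 2 * κ ^ 4 * d ^ 2) := fun i => by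
    have hI2 : Integrable (fun ω => ∑ a, (x i ω a) ^ 2) P :=
      integrable_finsetSum _ fun a _ => hsq i a
    have hI4 : Integrable (fun ω => d * ∑ a, (x i ω a) ^ 4) P :=
      (integrable_finsetSum _ fun a _ => hfour i a).const_mul _
    have hpt : ∀ ω, Real.exp (-l * ‖x i ω‖ ^ 2) ≤
        1 - l * ∑ a, (x i ω a) ^ 2 + l ^ 2 / 2 * (d * ∑ a, (x i ω a) ^ 4) := fun ω => by
      have h1 := exp_neg_le_quadratic (mul_nonneg hl (sq_nonneg ‖x i ω‖))
      have h2 : (‖x i ω‖ ^ 2) ^ 2 ≤ d * ∑ a, (x i ω a) ^ 4 := by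
        rw [hns]
        have := sq_sum_le_card_mul_sum_sq (s := Finset.univ) (f := fun a => (x i ω a) ^ 2)
        simp only [Finset.card_univ, Fintype.card_fin, ← pow_mul] at this
        exact this
      rw [neg_mul, ← hns]
      refine h1.trans ?_
      rw [mul_pow]
      nlinarith [sq_nonneg l, mul_le_mul_of_nonneg_left h2 (sq_nonneg l)]
    have hR : Integrable (fun ω => 1 - l * ∑ a, (x i ω a) ^ 2 +
        l ^ 2 / 2 * (d * ∑ a, (x i ω a) ^ 4)) P :=
      ((integrable_const _).sub (hI2.const_mul l)).add (hI4.const_mul _)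
    have hL : Integrable (fun ω => Real.exp (-l * ‖x i ω‖ ^ 2)) P := by
      refine hR.mono' ((hnm i).const_mul _).exp.aestronglyMeasurable
        (Filter.Eventually.of_forall fun ω => ?_)
      rw [Real.norm_of_nonneg (Real.exp_nonneg _)]
      exact hpt ω
    refine lintegral_eexp_le_of_integral hL ((integral_mono hL hR hpt).trans ?_)
    have hI1 : Integrable (fun ω => 1 - l * ∑ a, (x i ω a) ^ 2) P :=
      (integrable_const _).sub (hI2.const_mul l)
    rw [integral_add hI1 (hI4.const_mul _),
      integral_sub (integrable_const _) (hI2.const_mul l), integral_const_mul, integral_const_mul,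
      integral_const_mul, integral_finsetSum _ fun a _ => hsq i a,
      integral_finsetSum _ fun a _ => hfour i a]
    have htr : ∑ a, ∫ ω, (x i ω a) ^ 2 ∂P = A.trace := by
      rw [Matrix.trace]
      refine Finset.sum_congr rfl fun a _ => ?_
      rw [Matrix.diag_apply, ← h.covariance i a a]
      simp_rw [sq]
    have h4 : ∑ a, ∫ ω, (x i ω a) ^ 4 ∂P ≤ d * (4 * κ ^ 4) := by
      calc ∑ a, ∫ ω, (x i ω a) ^ 4 ∂P ≤ ∑ _a : Fin d, 4 * κ ^ 4 :=
            Finset.sum_le_sum fun a _ => integral_pow_four_le hκ (h.measurable_apply i a)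
              (h.lintegral_eexp_apply_sq i a)
        _ = d * (4 * κ ^ 4) := by simp
    rw [htr]
    simp only [integral_const, probReal_univ, one_smul]
    have h5 : l ^ 2 / 2 * (d * ∑ a, ∫ ω, (x i ω a) ^ 4 ∂P) ≤
        l ^ 2 / 2 * (d * (d * (4 * κ ^ 4))) := by gcongr
    have h6 := Real.add_one_le_exp (-l * A.trace + 2 * l ^ 2 * κ ^ 4 * d ^ 2)
    nlinarith
  have hm : Measurable fun y : EuclideanSpace ℝ (Fin d) => eexp (-l * ‖y‖ ^ 2) :=
    Measurable.eexp ((measurable_norm.pow_const 2).const_mul _)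
  have hsum : ∀ ω, eexp (l * (n * A.trace - ∑ i, ‖x i ω‖ ^ 2)) =
      eexp (l * (n * A.trace)) * ∏ i, eexp (-l * ‖x i ω‖ ^ 2) := fun ω => by
    rw [← eexp_sum, ← eexp_add, ← Finset.mul_sum]
    ring_nf
  have hmi : ∀ i, Measurable fun ω => eexp (-l * ‖x i ω‖ ^ 2) := fun i => hm.comp (h.measurable i)
  rw [lintegral_congr hsum, lintegral_const_mul _ (Finset.measurable_prod _ fun i _ => hmi i),
    lintegral_prod_eq_prod_lintegral_of_indepFun Finset.univ
    (fun i ω => eexp (-l * ‖x i ω‖ ^ 2)) (h.indep.comp _ fun _ => hm) hmi]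
  refine (mul_le_mul_right (Finset.prod_le_prod' fun i _ => hone i) _).trans (le_of_eq ?_)
  rw [Finset.prod_const, eexp_pow, Finset.card_univ, Fintype.card_fin, ← eexp_add]
  ring_nf

variable {m k : ℕ} {p : (Fin n → Fin m) → ℝ}

/-- Exponential moments of the quadratic form of `meanBagOp`. -/
lemma IsSubgaussianDesign.lintegral_eexp_meanBagOp_le (h : IsSubgaussianDesign κ A x P)
    (hκ : 0 < κ) (hp : ∀ b, 0 ≤ p b) (hp1 : ∑ b, p b = 1)
    (hpb : ∀ b, p b ≠ 0 → ∀ l, (bag b l).card = k)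
    {u : EuclideanSpace ℝ (Fin d)} (hu : ‖u‖ = 1) {c : ℝ}
    (hc : 128 * c ^ 2 * κ ^ 4 * k ^ 2 ≤ 1) :
    ∫⁻ ω, eexp (c * inner ℝ (meanBagOp p (fun i => x i ω) u) u) ∂P ≤
      eexp (64 * c ^ 2 * κ ^ 4 * k * n) := by
  let y : Fin n → Ω → Unit → ℝ := fun i ω _ => inner ℝ (x i ω) u
  have hym : ∀ i, Measurable (y i) := fun i =>
    measurable_pi_lambda _ fun _ => h.measurable_inner i u
  have hyind : iIndepFun y P :=
    h.indep.comp (fun _ z (_ : Unit) => inner ℝ z u) fun _ =>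
      measurable_pi_lambda _ fun _ => measurable_id.inner measurable_const
  have hyK : ∀ i (t : Unit → ℝ), ∫⁻ ω, eexp (∑ a, t a * y i ω a) ∂P ≤
      eexp (κ ^ 2 * ∑ a, t a ^ 2) := fun i t => by
    have := lintegral_eexp_mul_le hκ (h.measurable_inner i u)
      (h.lintegral_eexp_inner_sq i hu) (h.integral_inner hκ i u) (t ())
    simpa [y] using this
  have hquad : ∀ ω, c * inner ℝ (meanBagOp p (fun i => x i ω) u) u =
      ∑ b, p b * (c * bagChaos b fun i => y i ω) := fun ω => by
    rw [meanBagOp_apply, sum_inner, Finset.mul_sum]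
    refine Finset.sum_congr rfl fun b _ => ?_
    have : inner ℝ (bagOp b (fun i => x i ω) u) u = bagChaos b fun i => y i ω := by
      rw [bagOp_apply, sum_inner, bagChaos]
      refine Finset.sum_congr rfl fun i _ => ?_
      rw [sum_inner]
      refine Finset.sum_congr rfl fun j _ => ?_
      split_ifs
      · simp [y, real_inner_smul_left, mul_comm]
      · simp
    rw [real_inner_smul_left, this]
    ring
  rw [lintegral_congr fun ω => congrArg eexp (hquad ω)]
  refine lintegral_eexp_sum_mul_le _ _ _ (fun b => ?_) (fun b _ => hp b) hp1 fun b _ hb => ?_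
  · exact ((measurable_bagChaos b).comp (measurable_pi_lambda _ hym)).const_mul c
  · refine (lintegral_eexp_bagChaos_le hym hyind (sq_nonneg κ) hyK (fun l => (hpb b hb l).le)
      (by nlinarith)).trans (eexp_mono (le_of_eq ?_))
    have hn : (n : ℝ) = m * k := by exact_mod_cast (card_eq_mul_of_bag (hpb b hb)).symm
    rw [hn, Fintype.card_unit]
    push_cast
    ring

/-- Exponential moments of the trace of `meanBagOp`. -/
lemma IsSubgaussianDesign.lintegral_eexp_sum_bagChaos_le (h : IsSubgaussianDesign κ A x P)
    (hκ : 0 < κ) (hp : ∀ b, 0 ≤ p b) (hp1 : ∑ b, p b = 1)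
    (hpb : ∀ b, p b ≠ 0 → ∀ l, (bag b l).card = k) {c : ℝ}
    (hc : 128 * c ^ 2 * κ ^ 4 * k ^ 2 ≤ 1) :
    ∫⁻ ω, eexp (c * ∑ b, p b * bagChaos b fun i a => x i ω a) ∂P ≤
      eexp (64 * c ^ 2 * κ ^ 4 * k * n * d) := by
  let y : Fin n → Ω → Fin d → ℝ := fun i ω a => x i ω a
  have hym : ∀ i, Measurable (y i) := fun i =>
    measurable_pi_lambda _ fun a => h.measurable_apply i a
  have hyind : iIndepFun y P :=
    h.indep.comp (fun _ (z : EuclideanSpace ℝ (Fin d)) a => z a) fun _ =>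
      measurable_pi_lambda _ fun a => by fun_prop
  simp_rw [Finset.mul_sum, mul_left_comm c]
  refine lintegral_eexp_sum_mul_le _ _ _ (fun b => ?_) (fun b _ => hp b) hp1 fun b _ hb => ?_
  · exact ((measurable_bagChaos b).comp (measurable_pi_lambda _ hym)).const_mul c
  · refine (lintegral_eexp_bagChaos_le hym hyind (sq_nonneg κ) (h.lintegral_eexp_sum_le hκ)
      (fun l => (hpb b hb l).le) (by nlinarith)).trans (eexp_mono (le_of_eq ?_))
    have hn : (n : ℝ) = m * k := by exact_mod_cast (card_eq_mul_of_bag (hpb b hb)).symm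
    rw [hn, Fintype.card_fin]
    ring

end Design

/-! ### The good event -/

section Tails

variable {n d : ℕ} {κ : ℝ} {A : Matrix (Fin d) (Fin d) ℝ}
  {x : Fin n → Ω → EuclideanSpace ℝ (Fin d)} {P : Measure Ω}

/-- The union bound over a net of the unit sphere, for the norm of a random symmetric operator. -/
lemma measure_norm_gt_le_of_forall_unit
    {T : Ω → EuclideanSpace ℝ (Fin d) →L[ℝ] EuclideanSpace ℝ (Fin d)}
    (hT : ∀ ω, (T ω : EuclideanSpace ℝ (Fin d) →ₗ[ℝ] EuclideanSpace ℝ (Fin d)).IsSymmetric)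
    {s : ℝ} (hs : 0 ≤ s) {δ : ENNReal}
    (h1 : ∀ u, ‖u‖ = 1 → P {ω | s ≤ inner ℝ (T ω u) u} ≤ δ)
    (h2 : ∀ u, ‖u‖ = 1 → P {ω | s ≤ -inner ℝ (T ω u) u} ≤ δ) :
    P {ω | 32 * s < ‖T ω‖} ≤ 5 ^ d * (2 * δ) := by
  obtain ⟨N, hcard, hN, hcov⟩ := exists_finset_net_sphere (E := EuclideanSpace ℝ (Fin d))
  rw [finrank_euclideanSpace_fin] at hcard
  have hsub : {ω | 32 * s < ‖T ω‖} ⊆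
      ⋃ u ∈ N, ({ω | s ≤ inner ℝ (T ω u) u} ∪ {ω | s ≤ -inner ℝ (T ω u) u}) := by
    intro ω (hω : 32 * s < ‖T ω‖)
    by_contra hnot
    refine absurd (norm_le_of_net (hT ω) hN hcov hs fun u hu => ?_) (not_le.2 hω)
    simp only [Set.mem_iUnion, not_exists] at hnot
    have := hnot u hu
    simp only [Set.mem_union, Set.mem_ofPred_eq, not_or, not_le] at this
    exact abs_le.2 ⟨by linarith [this.2], this.1.le⟩
  calc P {ω | 32 * s < ‖T ω‖}
      ≤ ∑ u ∈ N, P ({ω | s ≤ inner ℝ (T ω u) u} ∪ {ω | s ≤ -inner ℝ (T ω u) u}) :=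
        (measure_mono hsub).trans (measure_biUnion_finset_le _ _)
    _ ≤ ∑ _u ∈ N, 2 * δ := by
        refine Finset.sum_le_sum fun u hu => (measure_union_le _ _).trans ?_
        rw [two_mul]
        exact add_le_add (h1 u (hN u hu)) (h2 u (hN u hu))
    _ = N.card * (2 * δ) := by rw [Finset.sum_const, nsmul_eq_mul]
    _ ≤ 5 ^ d * (2 * δ) := by
        gcongr
        exact_mod_cast hcard

lemma isSymmetric_gramOp (X : Fin n → EuclideanSpace ℝ (Fin d)) :
    (gramOp X : EuclideanSpace ℝ (Fin d) →ₗ[ℝ] EuclideanSpace ℝ (Fin d)).IsSymmetric := by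
  intro u v
  simp only [ContinuousLinearMap.coe_coe, gramOp_apply, sum_inner, inner_sum,
    real_inner_smul_left, real_inner_smul_right]
  refine Finset.sum_congr rfl fun i _ => ?_
  rw [real_inner_comm (X i) u]
  ring

lemma isSymmetric_bagOp {m : ℕ} (b : Fin n → Fin m) (X : Fin n → EuclideanSpace ℝ (Fin d)) :
    (bagOp b X : EuclideanSpace ℝ (Fin d) →ₗ[ℝ] EuclideanSpace ℝ (Fin d)).IsSymmetric := by
  intro u v
  simp only [ContinuousLinearMap.coe_coe, bagOp_apply, sum_inner, inner_sum]
  rw [Finset.sum_comm]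
  refine Finset.sum_congr rfl fun i _ => Finset.sum_congr rfl fun j _ => ?_
  by_cases h : i ≠ j ∧ b i = b j
  · rw [if_pos h, if_pos ⟨h.1.symm, h.2.symm⟩, real_inner_smul_left, real_inner_smul_right,
      real_inner_comm (X i) u]
    ring
  · rw [if_neg h, if_neg fun h' => h ⟨h'.1.symm, h'.2.symm⟩, inner_zero_left, inner_zero_right]

lemma isSymmetric_meanBagOp {m : ℕ} (p : (Fin n → Fin m) → ℝ)
    (X : Fin n → EuclideanSpace ℝ (Fin d)) :
    (meanBagOp p X : EuclideanSpace ℝ (Fin d) →ₗ[ℝ] EuclideanSpace ℝ (Fin d)).IsSymmetric := by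
  intro u v
  simp only [ContinuousLinearMap.coe_coe, meanBagOp_apply, sum_inner, inner_sum,
    real_inner_smul_left, real_inner_smul_right]
  exact Finset.sum_congr rfl fun b _ => congrArg _ (isSymmetric_bagOp b X u v)

lemma isSymmetric_toEuclideanCLM (hA : A.IsHermitian) :
    (Matrix.toEuclideanCLM (𝕜 := ℝ) A : EuclideanSpace ℝ (Fin d) →ₗ[ℝ] _).IsSymmetric :=
  Matrix.isSymmetric_toEuclideanLin_iff.2 hA

lemma sqrt_div_mul_self (hn : 0 < n) : √((d : ℝ) / n) * √((d : ℝ) / n) * n = d := by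
  rw [Real.mul_self_sqrt (by positivity)]
  field_simp

lemma sqrt_div_le_one (hdn : d ≤ n) : √((d : ℝ) / n) ≤ 1 := by
  refine Real.sqrt_le_one.2 ?_
  exact div_le_one_of_le₀ (by exact_mod_cast hdn) (by positivity)

variable [IsProbabilityMeasure P]

lemma IsSubgaussianDesign.measure_gramOp_sub_gt_le (h : IsSubgaussianDesign κ A x P) (hκ : 0 < κ)
    (hA : A.IsHermitian) (hn : 0 < n) (hdn : d ≤ n) :
    P {ω | 32 * (60 * κ ^ 2 * √(d / n)) <
      ‖(1 / n : ℝ) • gramOp (design x ω) - Matrix.toEuclideanCLM (𝕜 := ℝ) A‖} ≤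
      5 ^ d * (2 * eexp (-(4 * d))) := by
  set r := √((d : ℝ) / n) with hr
  have hr0 : 0 ≤ r := Real.sqrt_nonneg _
  have hr1 : r ≤ 1 := sqrt_div_le_one hdn
  have hrr : r * r * n = d := sqrt_div_mul_self hn
  have hn' : (0 : ℝ) < n := by exact_mod_cast hn
  -- The Chernoff parameter `r / (2 κ²)` is the largest that the exponential moment bound allows
  -- when `d = n`.
  set l := r / (2 * κ ^ 2) with hl
  have hl0 : 0 ≤ l := by positivity
  have hlκ : 2 * κ ^ 2 * l = r := by rw [hl]; field_simp
  have hexp : 16 * l ^ 2 * κ ^ 4 * n - l * (n * (60 * κ ^ 2 * r)) ≤ -(4 * d) := by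
    have h1 : 16 * l ^ 2 * κ ^ 4 * n = 4 * d := by
      rw [← hrr, ← hlκ]; ring
    have h2 : l * (n * (60 * κ ^ 2 * r)) = 30 * d := by
      rw [← hrr]
      calc l * (n * (60 * κ ^ 2 * r)) = 30 * (2 * κ ^ 2 * l) * r * n := by ring
        _ = 30 * (r * r * n) := by rw [hlκ]; ring
    rw [h1, h2]
    have : (0 : ℝ) ≤ d := by positivity
    linarith
  have hquad : ∀ ω u, inner ℝ (((1 / n : ℝ) • gramOp (design x ω) -
      Matrix.toEuclideanCLM (𝕜 := ℝ) A) u) u = (1 / n : ℝ) * (∑ i, (inner ℝ (x i ω) u) ^ 2 -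
        n * inner ℝ (Matrix.toEuclideanCLM (𝕜 := ℝ) A u) u) := fun ω u => by
    rw [sub_apply, smul_apply, inner_sub_left, real_inner_smul_left, gramOp_apply, sum_inner]
    simp_rw [real_inner_smul_left, design]
    field_simp
  have hm : ∀ u, Measurable fun ω => ∑ i, (inner ℝ (x i ω) u) ^ 2 -
        n * inner ℝ (Matrix.toEuclideanCLM (𝕜 := ℝ) A u) u := fun u =>
    (Finset.measurable_sum _ fun i _ => (h.measurable_inner i u).pow_const 2).sub_const _
  refine measure_norm_gt_le_of_forall_unit (fun ω => ?_) (by positivity) (fun u hu => ?_)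
    fun u hu => ?_
  · have h1 := isSymmetric_gramOp (design x ω)
    have h2 := isSymmetric_toEuclideanCLM hA
    intro u v
    have h1' := h1 u v
    have h2' := h2 u v
    simp only [ContinuousLinearMap.coe_coe] at h1' h2' ⊢
    simp only [sub_apply, smul_apply, inner_sub_left, inner_sub_right, real_inner_smul_left,
      real_inner_smul_right, h1', h2']
  · refine le_trans (measure_mono ?_) ((measure_le_eexp (hm u) (a := n * (60 * κ ^ 2 * r)) hl0
      (h.lintegral_eexp_sum_inner_sq_le hκ hu ?_)).trans (eexp_mono hexp))
    · intro ω (hω : 60 * κ ^ 2 * r ≤ _)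
      rw [hquad, one_div_mul_eq_div, le_div_iff₀ hn'] at hω
      rw [Set.mem_ofPred_eq]
      linarith
    · rw [abs_of_nonneg hl0, hlκ]
      exact hr1
  · refine le_trans (measure_mono ?_) ((measure_le_eexp (hm u).neg (a := n * (60 * κ ^ 2 * r))
      (M := 16 * l ^ 2 * κ ^ 4 * n) hl0 ?_).trans (eexp_mono hexp))
    · intro ω (hω : 60 * κ ^ 2 * r ≤ _)
      rw [hquad, ← mul_neg, one_div_mul_eq_div, le_div_iff₀ hn'] at hω
      rw [Set.mem_ofPred_eq, Pi.neg_apply]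
      linarith
    · have := h.lintegral_eexp_sum_inner_sq_le hκ hu (l := -l)
        (by rw [abs_neg, abs_of_nonneg hl0, hlκ]; exact hr1)
      simp_rw [neg_mul, ← mul_neg, neg_sq] at this
      exact this

variable {m k : ℕ} {p : (Fin n → Fin m) → ℝ}

lemma IsSubgaussianDesign.measure_meanBagOp_gt_le (h : IsSubgaussianDesign κ A x P) (hκ : 0 < κ)
    (hn : 0 < n) (hdn : d ≤ n) (hk : 1 ≤ k) (hp : ∀ b, 0 ≤ p b) (hp1 : ∑ b, p b = 1)
    (hpb : ∀ b, p b ≠ 0 → ∀ l, (bag b l).card = k) :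
    P {ω | 32 * (60 * κ ^ 2 * √(d / n)) < ‖(1 / (n * k) : ℝ) • meanBagOp p (design x ω)‖} ≤
      5 ^ d * (2 * eexp (-(4 * d))) := by
  set r := √((d : ℝ) / n) with hr
  have hr0 : 0 ≤ r := Real.sqrt_nonneg _
  have hr1 : r ≤ 1 := sqrt_div_le_one hdn
  have hrr : r * r * n = d := sqrt_div_mul_self hn
  have hn' : (0 : ℝ) < n := by exact_mod_cast hn
  have hk1 : (1 : ℝ) ≤ k := by exact_mod_cast hk
  have hk' : (0 : ℝ) < k := by linarith
  -- The factor `12 ≥ √128` makes `l` admissible for the moment bound of the chaos.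
  set l := r / (12 * κ ^ 2 * k) with hl
  have hl0 : 0 ≤ l := by positivity
  have hlκ : 12 * κ ^ 2 * k * l = r := by rw [hl]; field_simp
  have hlim : 128 * l ^ 2 * κ ^ 4 * k ^ 2 ≤ 1 := by
    have : 128 * l ^ 2 * κ ^ 4 * k ^ 2 = 128 / 144 * r ^ 2 := by rw [← hlκ]; ring
    rw [this]
    nlinarith
  have hexp : 64 * l ^ 2 * κ ^ 4 * k * n - l * (n * k * (60 * κ ^ 2 * r)) ≤ -(4 * d) := by
    have h1 : 64 * l ^ 2 * κ ^ 4 * k * n ≤ d := by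
      have h3 : 64 * l ^ 2 * κ ^ 4 * k * n ≤ 64 * l ^ 2 * κ ^ 4 * k * n * k :=
        le_mul_of_one_le_right (by positivity) hk1
      have h4 : 64 * l ^ 2 * κ ^ 4 * k * n * k = 64 / 144 * d := by
        rw [← hrr, ← hlκ]; ring
      have : (0 : ℝ) ≤ d := by positivity
      linarith
    have h2 : l * (n * k * (60 * κ ^ 2 * r)) = 5 * d := by
      rw [← hrr]
      calc l * (n * k * (60 * κ ^ 2 * r)) = 5 * (12 * κ ^ 2 * k * l) * r * n := by ring
        _ = 5 * (r * r * n) := by rw [hlκ]; ring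
    linarith
  have hm : ∀ u, Measurable fun ω => inner ℝ (meanBagOp p (fun i => x i ω) u) u := fun u => by
    have h1 : Continuous fun X : Fin n → EuclideanSpace ℝ (Fin d) =>
        inner ℝ (meanBagOp p X u) u :=
      ((continuous_meanBagOp p).clm_apply continuous_const).inner continuous_const
    exact h1.measurable.comp (measurable_pi_lambda _ h.measurable)
  refine measure_norm_gt_le_of_forall_unit (fun ω => ?_) (by positivity) (fun u hu => ?_)
    fun u hu => ?_
  · intro u v
    have h1 := isSymmetric_meanBagOp p (design x ω) u v
    simp only [ContinuousLinearMap.coe_coe] at h1 ⊢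
    simp only [smul_apply, real_inner_smul_left, real_inner_smul_right, h1]
  · refine le_trans (measure_mono ?_) ((measure_le_eexp (hm u) (a := n * k * (60 * κ ^ 2 * r)) hl0
      (h.lintegral_eexp_meanBagOp_le hκ hp hp1 hpb hu hlim)).trans (eexp_mono hexp))
    intro ω (hω : 60 * κ ^ 2 * r ≤ _)
    rw [smul_apply, real_inner_smul_left, one_div_mul_eq_div, le_div_iff₀ (by positivity)] at hω
    rw [Set.mem_ofPred_eq]
    exact le_trans (by linarith) hω
  · refine le_trans (measure_mono ?_) ((measure_le_eexp (hm u).neg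
      (a := n * k * (60 * κ ^ 2 * r)) (M := 64 * l ^ 2 * κ ^ 4 * k * n) hl0 ?_).trans
      (eexp_mono hexp))
    · intro ω (hω : 60 * κ ^ 2 * r ≤ _)
      rw [smul_apply, real_inner_smul_left, ← mul_neg, one_div_mul_eq_div,
        le_div_iff₀ (by positivity)] at hω
      rw [Set.mem_ofPred_eq, Pi.neg_apply]
      exact le_trans (by linarith) hω
    · have := h.lintegral_eexp_meanBagOp_le hκ hp hp1 hpb hu (c := -l) (by rwa [neg_sq])
      simpa using this

/-- The lower tail of the trace. The exponent `η` is chosen so small that the Chernoff parameter is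
admissible in every dimension and the quadratic term is at most half of the linear one. -/
lemma IsSubgaussianDesign.measure_trace_lt_le (h : IsSubgaussianDesign κ A x P) (hκ : 0 < κ)
    (hd : 2 ≤ d) (hdn : d ≤ n) (hp : ∀ b, 0 ≤ p b) (hp1 : ∑ b, p b = 1)
    (hpb : ∀ b, p b ≠ 0 → ∀ l, (bag b l).card = k) (hkn : k ≤ n) {η : ℝ} (hη : 0 < η)
    (hη1 : 256 * η * κ ^ 4 ≤ 1) (hη2 : 12 * η * κ ^ 2 ≤ 1) :
    P {ω | ∑ i, ‖x i ω‖ ^ 2 + ∑ b, p b * bagChaos b (fun i a => x i ω a) <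
      n * (A.trace - √(d * Real.log d))} ≤ 2 * ENNReal.ofReal ((d : ℝ) ^ (-(η / 4))) := by
  have hd' : (2 : ℝ) ≤ d := by exact_mod_cast hd
  have hn' : (0 : ℝ) < n := by
    have : 0 < n := by omega
    exact_mod_cast this
  have hdn' : (d : ℝ) ≤ n := by exact_mod_cast hdn
  have hkn' : (k : ℝ) ≤ n := by exact_mod_cast hkn
  have hlog : 0 < Real.log d := Real.log_pos (by linarith)
  set s := √(d * Real.log d) / 2 with hs
  set w := √(Real.log d / d) with hw
  have hw0 : 0 ≤ w := Real.sqrt_nonneg _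
  have hws : w * s = Real.log d / 2 := by
    rw [hw, hs, ← mul_div_assoc, ← Real.sqrt_mul (by positivity)]
    congr 1
    rw [show Real.log d / d * (d * Real.log d) = Real.log d * Real.log d by field_simp]
    exact Real.sqrt_mul_self hlog.le
  have hww : w ^ 2 * d = Real.log d := by
    rw [hw, Real.sq_sqrt (by positivity)]
    field_simp
  have hw1 : w ^ 2 ≤ 1 := by
    rw [hw, Real.sq_sqrt (by positivity)]
    exact div_le_one_of_le₀ ((Real.log_le_sub_one_of_pos (by linarith)).trans (by linarith))
      (by linarith)
  set l := η * w / n with hl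
  have hl0 : 0 ≤ l := by positivity
  have hln : l * n = η * w := by rw [hl]; field_simp
  have hpow : eexp (-(η / 4) * Real.log d) = ENNReal.ofReal ((d : ℝ) ^ (-(η / 4))) := by
    rw [eexp, Real.rpow_def_of_pos (by linarith), mul_comm]
  have hlin : l * (n * s) = η / 2 * Real.log d := by
    rw [← mul_assoc, hln, mul_assoc, hws]
    ring
  have hquad : ∀ q : ℝ, q * η * κ ^ 4 ≤ 1 / 4 →
      q * (η ^ 2 * κ ^ 4 * (w ^ 2 * d)) - l * (n * s) ≤ -(η / 4) * Real.log d := fun q hq => by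
    rw [hlin, hww]
    have : q * (η ^ 2 * κ ^ 4 * Real.log d) ≤ η / 4 * Real.log d := by
      calc q * (η ^ 2 * κ ^ 4 * Real.log d) = (q * η * κ ^ 4) * (η * Real.log d) := by ring
        _ ≤ 1 / 4 * (η * Real.log d) := by gcongr
        _ = η / 4 * Real.log d := by ring
    linarith
  have hxm : ∀ i, Measurable fun ω => ‖x i ω‖ ^ 2 := fun i => (h.measurable i).norm.pow_const 2
  have hdiag : P {ω | n * s ≤ n * A.trace - ∑ i, ‖x i ω‖ ^ 2} ≤
      ENNReal.ofReal ((d : ℝ) ^ (-(η / 4))) := by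
    rw [← hpow]
    refine (measure_le_eexp (measurable_const.sub (Finset.measurable_sum _ fun i _ => hxm i)) hl0
      (h.lintegral_eexp_neg_sum_norm_sq_le hκ hl0)).trans (eexp_mono ?_)
    refine le_trans (sub_le_sub_right ?_ _) (hquad 2 (by linarith))
    calc 2 * l ^ 2 * κ ^ 4 * d ^ 2 * n ≤ 2 * l ^ 2 * κ ^ 4 * (d * n) * n := by
          gcongr
          nlinarith
      _ = 2 * ((l * n) ^ 2 * κ ^ 4 * d) := by ring
      _ = 2 * (η ^ 2 * κ ^ 4 * (w ^ 2 * d)) := by rw [hln]; ring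
  have hchaos : P {ω | n * s ≤ -∑ b, p b * bagChaos b (fun i a => x i ω a)} ≤
      ENNReal.ofReal ((d : ℝ) ^ (-(η / 4))) := by
    rw [← hpow]
    have hlim : 128 * (-l) ^ 2 * κ ^ 4 * k ^ 2 ≤ 1 := by
      calc 128 * (-l) ^ 2 * κ ^ 4 * k ^ 2 ≤ 128 * (-l) ^ 2 * κ ^ 4 * n ^ 2 := by gcongr
        _ = 128 * (l * n) ^ 2 * κ ^ 4 := by ring
        _ = 128 * (η * κ ^ 2) ^ 2 * w ^ 2 := by rw [hln]; ring
        _ ≤ 128 * (1 / 12) ^ 2 * 1 := by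
            gcongr
            linarith
        _ ≤ 1 := by norm_num
    have hmgf := h.lintegral_eexp_sum_bagChaos_le hκ hp hp1 hpb hlim
    have hmeas : Measurable fun ω => ∑ b, p b * bagChaos b (fun i a => x i ω a) :=
      Finset.measurable_sum _ fun b _ => ((measurable_bagChaos b).comp
        (measurable_pi_lambda _ fun i => measurable_pi_lambda _ fun a =>
          h.measurable_apply i a)).const_mul _
    simp_rw [neg_mul, ← mul_neg] at hmgf
    refine (measure_le_eexp hmeas.neg hl0 hmgf).trans (eexp_mono ?_)
    refine le_trans (sub_le_sub_right ?_ _) (hquad 64 (by linarith))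
    calc 64 * (-l) ^ 2 * κ ^ 4 * k * n * d ≤ 64 * (-l) ^ 2 * κ ^ 4 * n * n * d := by gcongr
      _ = 64 * ((l * n) ^ 2 * κ ^ 4 * d) := by ring
      _ = 64 * (η ^ 2 * κ ^ 4 * (w ^ 2 * d)) := by rw [hln]; ring
  rw [two_mul]
  refine le_trans (measure_mono ?_) ((measure_union_le _ _).trans (add_le_add hdiag hchaos))
  intro ω hω
  rw [Set.mem_ofPred_eq] at hω
  by_contra hnot
  simp only [Set.mem_union, Set.mem_ofPred_eq, not_or, not_le] at hnot
  have : √(d * Real.log d) = 2 * s := by rw [hs]; ring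
  rw [this] at hω
  linarith [hnot.1, hnot.2]

end Tails

/-- The designs for which the sample covariance and the mean off-diagonal bag operator, divided by
`n k`, are within `t` of their expectations `A` and `0`, and for which the sum of squared norms plus
the trace of the mean off-diagonal bag operator is not much smaller than its expectation. -/
def goodDesigns {n m d : ℕ} (k : ℕ) (p : (Fin n → Fin m) → ℝ) (A : Matrix (Fin d) (Fin d) ℝ)
    (t : ℝ) : Set (Fin n → EuclideanSpace ℝ (Fin d)) :=
  {X | ‖(1 / n : ℝ) • gramOp X - Matrix.toEuclideanCLM (𝕜 := ℝ) A‖ ≤ t ∧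
    ‖(1 / (n * k) : ℝ) • meanBagOp p X‖ ≤ t ∧
    n * (A.trace - √(d * Real.log d)) ≤
      ∑ i, ‖X i‖ ^ 2 + ∑ b, p b * bagChaos b fun i a => X i a}

lemma measurableSet_goodDesigns {n m d : ℕ} (k : ℕ) (p : (Fin n → Fin m) → ℝ)
    (A : Matrix (Fin d) (Fin d) ℝ) (t : ℝ) : MeasurableSet (goodDesigns k p A t) := by
  have h1 := continuous_gramOp (n := n) (d := d)
  have h2 := continuous_meanBagOp (d := d) p
  have h3 : Measurable fun X : Fin n → EuclideanSpace ℝ (Fin d) =>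
      ∑ i, ‖X i‖ ^ 2 + ∑ b, p b * bagChaos b fun i a => X i a := by
    refine (Finset.measurable_sum _ fun i _ => by fun_prop).add
      (Finset.measurable_sum _ fun b _ => Measurable.const_mul ?_ _)
    exact (measurable_bagChaos b).comp (by fun_prop)
  refine MeasurableSet.inter ?_ (MeasurableSet.inter ?_ (measurableSet_le measurable_const h3))
  · exact (isClosed_le (f := fun X => ‖(1 / n : ℝ) • gramOp X -
      Matrix.toEuclideanCLM (𝕜 := ℝ) A‖) (by fun_prop) continuous_const).measurableSet
  · exact (isClosed_le (f := fun X => ‖(1 / (n * k) : ℝ) • meanBagOp p X‖)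
      (by fun_prop) continuous_const).measurableSet

/-- Each of the two operator norm bounds fails with probability at most
`5 ^ d * 2 * exp (-4 d) ≤ exp (-d)`. -/
lemma IsSubgaussianDesign.le_measure_goodDesigns {n m d k : ℕ} {κ : ℝ} {P : Measure Ω}
    [IsProbabilityMeasure P] {A : Matrix (Fin d) (Fin d) ℝ}
    {x : Fin n → Ω → EuclideanSpace ℝ (Fin d)} (h : IsSubgaussianDesign κ A x P) (hκ : 0 < κ)
    (hA : A.IsHermitian) (hd : 2 ≤ d) (hdn : d ≤ n) (hk : 1 ≤ k) (hkn : k ≤ n)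
    {p : (Fin n → Fin m) → ℝ} (hp : ∀ b, 0 ≤ p b) (hp1 : ∑ b, p b = 1)
    (hpb : ∀ b, p b ≠ 0 → ∀ l, (bag b l).card = k) {η : ℝ} (hη : 0 < η)
    (hη1 : 256 * η * κ ^ 4 ≤ 1) (hη2 : 12 * η * κ ^ 2 ≤ 1) :
    ENNReal.ofReal (1 - 2 * Real.exp (-d) - 2 * (d : ℝ) ^ (-(η / 4))) ≤
      P (design x ⁻¹' goodDesigns k p A (1920 * κ ^ 2 * √(d / n))) := by
  have hn : 0 < n := by omega
  set S := goodDesigns k p A (1920 * κ ^ 2 * √(d / n)) with hS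
  have hSm : MeasurableSet (design x ⁻¹' S) :=
    (measurable_pi_lambda _ h.measurable : Measurable (design x)) (measurableSet_goodDesigns ..)
  have h32 : 1920 * κ ^ 2 * √((d : ℝ) / n) = 32 * (60 * κ ^ 2 * √(d / n)) := by ring
  have hbad : P (design x ⁻¹' S)ᶜ ≤
      ENNReal.ofReal (2 * Real.exp (-d) + 2 * (d : ℝ) ^ (-(η / 4))) := by
    have hsub : (design x ⁻¹' S)ᶜ ⊆
        ({ω | 32 * (60 * κ ^ 2 * √(d / n)) <
          ‖(1 / n : ℝ) • gramOp (design x ω) - Matrix.toEuclideanCLM (𝕜 := ℝ) A‖} ∪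
        {ω | 32 * (60 * κ ^ 2 * √(d / n)) < ‖(1 / (n * k) : ℝ) • meanBagOp p (design x ω)‖}) ∪
        {ω | ∑ i, ‖x i ω‖ ^ 2 + ∑ b, p b * bagChaos b (fun i a => x i ω a) <
          n * (A.trace - √(d * Real.log d))} := by
      intro ω hω
      by_contra hnot
      simp only [Set.mem_union, Set.mem_ofPred_eq, not_or, not_lt] at hnot
      refine hω ⟨?_, ?_, hnot.2⟩
      · rw [h32]; exact hnot.1.1
      · rw [h32]; exact hnot.1.2
    have hnum : (5 : ENNReal) ^ d * (2 * eexp (-(4 * d))) ≤ ENNReal.ofReal (Real.exp (-d)) := by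
      have h5 : (5 : ENNReal) ^ d * (2 * eexp (-(4 * d))) =
          ENNReal.ofReal (5 ^ d * (2 * Real.exp (-(4 * d)))) := by
        rw [ENNReal.ofReal_mul (by positivity), ENNReal.ofReal_mul (by positivity),
          ENNReal.ofReal_pow (by positivity), eexp]
        simp
      rw [h5]
      refine ENNReal.ofReal_le_ofReal ?_
      have he2 : (5 : ℝ) ≤ Real.exp 2 := by
        have := Real.quadratic_le_exp_of_nonneg (show (0 : ℝ) ≤ 2 by norm_num)
        linarith
      have h5d : (5 : ℝ) ^ d ≤ Real.exp (d * 2) := by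
        rw [Real.exp_nat_mul]
        exact pow_le_pow_left₀ (by norm_num) he2 d
      have h2d : (2 : ℝ) ≤ Real.exp d := by
        have := Real.add_one_le_exp (d : ℝ)
        have : (2 : ℝ) ≤ d := by exact_mod_cast hd
        linarith
      calc (5 : ℝ) ^ d * (2 * Real.exp (-(4 * d)))
          ≤ Real.exp (d * 2) * (Real.exp d * Real.exp (-(4 * d))) := by gcongr
        _ = Real.exp (-d) := by
          rw [← Real.exp_add, ← Real.exp_add]
          ring_nf
    calc P (design x ⁻¹' S)ᶜ
        ≤ ENNReal.ofReal (Real.exp (-d)) + ENNReal.ofReal (Real.exp (-d)) +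
          2 * ENNReal.ofReal ((d : ℝ) ^ (-(η / 4))) := by
          refine (measure_mono hsub).trans ((measure_union_le _ _).trans
            (add_le_add ((measure_union_le _ _).trans (add_le_add ?_ ?_)) ?_))
          · exact (h.measure_gramOp_sub_gt_le hκ hA hn hdn).trans hnum
          · exact (h.measure_meanBagOp_gt_le hκ hn hdn hk hp hp1 hpb).trans hnum
          · exact h.measure_trace_lt_le hκ hd hdn hp hp1 hpb hkn hη hη1 hη2
      _ = ENNReal.ofReal (2 * Real.exp (-d) + 2 * (d : ℝ) ^ (-(η / 4))) := by
          rw [ENNReal.ofReal_add (by positivity) (by positivity),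
            ENNReal.ofReal_mul (by positivity), ENNReal.ofReal_mul (by positivity),
            ← two_mul]
          simp
  rw [sub_sub, ENNReal.ofReal_sub _ (by positivity), ENNReal.ofReal_one, tsub_le_iff_right]
  calc (1 : ENNReal) = P (design x ⁻¹' S) + P (design x ⁻¹' S)ᶜ := by
        rw [measure_add_measure_compl hSm, measure_univ]
    _ ≤ _ := by gcongr

/-! ### The lower bound for a good design -/

lemma sigmaMin_pos {d : ℕ} (hd : 0 < d) {A : Matrix (Fin d) (Fin d) ℝ} (hA : A.PosDef) :
    0 < sigmaMin A := by
  have hinj : Function.Injective (Matrix.toEuclideanLin A) := by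
    intro u v huv
    have h1 : A.mulVec u.ofLp = A.mulVec v.ofLp := congrArg WithLp.ofLp huv
    exact WithLp.ofLp_injective 2 (Matrix.mulVec_injective_of_isUnit hA.isUnit h1)
  refine (Matrix.toEuclideanLin A).injective_iff_forall_lt_finrank_singularValues_pos.1 hinj
    (d - 1) ?_
  rw [finrank_euclideanSpace_fin]
  omega

section Good

variable {n m d k : ℕ} {p : (Fin n → Fin m) → ℝ} {A : Matrix (Fin d) (Fin d) ℝ} {t : ℝ}
  {X : Fin n → EuclideanSpace ℝ (Fin d)}

lemma norm_gramOp_apply_le (hn : 0 < n) (hX : X ∈ goodDesigns k p A t)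
    (v : EuclideanSpace ℝ (Fin d)) : ‖gramOp X v‖ ≤ n * (opNorm A + t) * ‖v‖ := by
  have hn' : (0 : ℝ) < n := by exact_mod_cast hn
  have h1 : ‖(1 / n : ℝ) • gramOp X‖ ≤ opNorm A + t := by
    have h2 : (1 / n : ℝ) • gramOp X = Matrix.toEuclideanCLM (𝕜 := ℝ) A +
        ((1 / n : ℝ) • gramOp X - Matrix.toEuclideanCLM (𝕜 := ℝ) A) := by abel
    rw [h2]
    exact (norm_add_le _ _).trans (add_le_add le_rfl hX.1)
  have h3 := ContinuousLinearMap.le_of_opNorm_le _ h1 v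
  rw [smul_apply, norm_smul, Real.norm_of_nonneg (by positivity), one_div_mul_eq_div,
    div_le_iff₀ hn'] at h3
  linarith

/-- The common lower bound in both cases: the bias contributes `β²`, and the variance contributes
through the lower bound on `R` and the trace. -/
lemma le_meanRisk_of_mem_goodDesigns (hn : 0 < n) (hk : 1 ≤ k) (hp : ∀ b, 0 ≤ p b)
    (hp1 : ∑ b, p b = 1) (hpb : ∀ b, p b ≠ 0 → ∀ l, (bag b l).card = k) {σ β : ℝ}
    {θs : EuclideanSpace ℝ (Fin d)} (hg : 0 < opNorm A + t)
    (hX : X ∈ goodDesigns k p A t)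
    {R : EuclideanSpace ℝ (Fin d) →L[ℝ] EuclideanSpace ℝ (Fin d)} (hβ : 0 ≤ β)
    (hR : ∀ v, 1 / (n * (opNorm A + t)) * ‖v‖ ≤ ‖R v‖)
    (hbias : β ≤ ‖R ((1 / k : ℝ) • meanBagOp p X θs - (1 - 1 / k : ℝ) • gramOp X θs)‖) :
    β ^ 2 + σ ^ 2 * (1 / ((k : ℝ) * n)) * ((A.trace - √(d * Real.log d)) /
      (opNorm A + t) ^ 2) ≤ meanRisk k p σ θs R X := by
  have hn' : (0 : ℝ) < n := by exact_mod_cast hn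
  have hk' : (0 : ℝ) < k := by exact_mod_cast hk
  refine le_trans ?_ (le_meanRisk hk hp hp1 hpb hβ (by positivity) hR hbias)
  gcongr ?_ + ?_
  · exact le_rfl
  have h1 : σ ^ 2 * (1 / ((k : ℝ) * n)) * ((A.trace - √(d * Real.log d)) / (opNorm A + t) ^ 2) =
      σ ^ 2 * (1 / (n * (opNorm A + t))) ^ 2 * (1 / k) *
        (n * (A.trace - √(d * Real.log d))) := by
    field_simp
  rw [h1]
  exact mul_le_mul_of_nonneg_left hX.2.2 (by positivity)

/-- On a good design with `2 t ≤ sigmaMin A` the operator `gramOp X` is invertible, with a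
quantitative lower bound. -/
lemma mul_norm_le_gramOp (hn : 0 < n) (hX : X ∈ goodDesigns k p A t)
    (ht2 : 2 * t ≤ sigmaMin A) (u : EuclideanSpace ℝ (Fin d)) :
    n * (sigmaMin A / 2) * ‖u‖ ≤ ‖gramOp X u‖ := by
  have hn' : (0 : ℝ) < n := by exact_mod_cast hn
  have h := sub_mul_norm_le_of_norm_sub_le (sigmaMin_mul_norm_le A) hX.1 u
  rw [smul_apply, norm_smul, Real.norm_of_nonneg (by positivity), one_div_mul_eq_div,
    le_div_iff₀ hn'] at h
  refine le_trans ?_ h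
  have := norm_nonneg u
  have h1 : sigmaMin A / 2 * ‖u‖ ≤ (sigmaMin A - t) * ‖u‖ := by
    gcongr
    linarith
  nlinarith

lemma le_norm_inverse_gramOp_bias (hn : 0 < n) (hk : 1 ≤ k) (hσ : 0 < sigmaMin A)
    (hX : X ∈ goodDesigns k p A t) (ht2 : 2 * t ≤ sigmaMin A)
    (θs : EuclideanSpace ℝ (Fin d)) :
    (1 - 1 / (k : ℝ) - 2 * t / sigmaMin A) * ‖θs‖ ≤
      ‖Ring.inverse (gramOp X)
        ((1 / k : ℝ) • meanBagOp p X θs - (1 - 1 / k : ℝ) • gramOp X θs)‖ := by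
  have hn' : (0 : ℝ) < n := by exact_mod_cast hn
  have hk1 : (1 : ℝ) ≤ k := by exact_mod_cast hk
  have hk' : (0 : ℝ) < k := by linarith
  have hlow := mul_norm_le_gramOp hn hX ht2
  have hunit : IsUnit (gramOp X) := isUnit_of_mul_norm_le (by positivity) hlow
  have hinv1 : ∀ v, Ring.inverse (gramOp X) (gramOp X v) = v := fun v =>
    congrArg (fun T : EuclideanSpace ℝ (Fin d) →L[ℝ] EuclideanSpace ℝ (Fin d) => T v)
      (Ring.inverse_mul_cancel _ hunit)
  have hinv2 : ∀ v, gramOp X (Ring.inverse (gramOp X) v) = v := fun v =>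
    congrArg (fun T : EuclideanSpace ℝ (Fin d) →L[ℝ] EuclideanSpace ℝ (Fin d) => T v)
      (Ring.mul_inverse_cancel _ hunit)
  set v := (1 / k : ℝ) • meanBagOp p X θs with hv
  have hvle : ‖v‖ ≤ n * t * ‖θs‖ := by
    have h1 := ContinuousLinearMap.le_of_opNorm_le _ hX.2.1 θs
    have h2 : v = (n : ℝ) • ((1 / (n * k) : ℝ) • meanBagOp p X) θs := by
      rw [hv, smul_apply, smul_smul]
      congr 1
      field_simp
    rw [h2, norm_smul, Real.norm_of_nonneg hn'.le, mul_assoc]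
    gcongr
  have hRv : ‖Ring.inverse (gramOp X) v‖ ≤ 2 * t / sigmaMin A * ‖θs‖ := by
    have h1 := hlow (Ring.inverse (gramOp X) v)
    rw [hinv2] at h1
    have h2 : n * (sigmaMin A / 2) * ‖Ring.inverse (gramOp X) v‖ ≤
        n * (sigmaMin A / 2) * (2 * t / sigmaMin A * ‖θs‖) := by
      refine h1.trans (hvle.trans (le_of_eq ?_))
      field_simp
    exact le_of_mul_le_mul_left h2 (by positivity)
  have hmain : ‖(1 - 1 / k : ℝ) • θs‖ = (1 - 1 / k : ℝ) * ‖θs‖ := by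
    rw [norm_smul, Real.norm_of_nonneg]
    rw [sub_nonneg, div_le_one hk']
    exact hk1
  rw [map_sub, map_smul _ (1 - 1 / k : ℝ) (gramOp X θs), hinv1, sub_mul, ← hmain, norm_sub_rev]
  exact (sub_le_sub_left hRv _).trans (norm_sub_norm_le _ _)

lemma mul_norm_le_inverse_gramOp (hn : 0 < n) (hσ : 0 < sigmaMin A)
    (hg : 0 < opNorm A + t) (hX : X ∈ goodDesigns k p A t) (ht2 : 2 * t ≤ sigmaMin A)
    (v : EuclideanSpace ℝ (Fin d)) :
    1 / (n * (opNorm A + t)) * ‖v‖ ≤ ‖Ring.inverse (gramOp X) v‖ := by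
  have hn' : (0 : ℝ) < n := by exact_mod_cast hn
  have hunit : IsUnit (gramOp X) :=
    isUnit_of_mul_norm_le (by positivity) (mul_norm_le_gramOp hn hX ht2)
  have hinv : gramOp X (Ring.inverse (gramOp X) v) = v :=
    congrArg (fun T : EuclideanSpace ℝ (Fin d) →L[ℝ] EuclideanSpace ℝ (Fin d) => T v)
      (Ring.mul_inverse_cancel _ hunit)
  have h := norm_gramOp_apply_le hn hX (Ring.inverse (gramOp X) v)
  rw [hinv] at h
  rw [one_div_mul_eq_div, div_le_iff₀ (by positivity)]
  linarith

end Good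

lemma sqrt_div_le_mul_sqrt_log {n d : ℕ} (hd : 2 ≤ d) :
    √((d : ℝ) / n) ≤ d * √(Real.log d) / √n := by
  have hd' : (2 : ℝ) ≤ d := by exact_mod_cast hd
  rw [Real.sqrt_div (by positivity)]
  gcongr
  have hlog : 1 / 2 ≤ Real.log d := by
    have h1 := Real.one_sub_inv_le_log_of_pos (show (0 : ℝ) < d by linarith)
    have h2 : (d : ℝ)⁻¹ ≤ 2⁻¹ := inv_anti₀ (by norm_num) hd'
    linarith
  calc √(d : ℝ) ≤ √(d ^ 2 * Real.log d) := by
        refine Real.sqrt_le_sqrt ?_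
        nlinarith
    _ = d * √(Real.log d) := by
        rw [Real.sqrt_mul (by positivity), Real.sqrt_sq (by positivity)]

end AggregateLearning

theorem mainTheorem5 :
    ∀ κ : ℝ, 0 < κ →
      ∃ C c c₀ c₁ : ℝ, 0 < C ∧ 0 < c ∧ 0 < c₀ ∧ 0 < c₁ ∧
        ∀ (n d m k : ℕ), d ≤ n → 1 ≤ k →
        ∀ (Ω : Type*) [MeasurableSpace Ω] (P : Measure Ω) [IsProbabilityMeasure P]
          (A : Matrix (Fin d) (Fin d) ℝ) (θs : EuclideanSpace ℝ (Fin d)) (σ : ℝ)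
          (x : Fin n → Ω → EuclideanSpace ℝ (Fin d)) (ε : Fin n → Ω → ℝ)
          (B : Ω → Fin n → Fin m) (θh : Ω → EuclideanSpace ℝ (Fin d)),
          A.PosDef →
          AggregateLearning.IsSubgaussianDesign κ A x P →
          AggregateLearning.IsWhiteNoise σ ε P →
          IndepFun (AggregateLearning.design x) (fun ω i => ε i ω) P →
          Measurable B →
          (∀ ω l, (AggregateLearning.bag (B ω) l).card = k) →
          IndepFun B (fun ω => (AggregateLearning.design x ω,
            AggregateLearning.response θs x ε ω)) P →
          Measurable θh →
          (∀ᵐ ω ∂P, IsMinOn (AggregateLearning.eventLoss (B ω) (AggregateLearning.design x ω)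
            (AggregateLearning.response θs x ε ω)) Set.univ (θh ω)) →
          ENNReal.ofReal (1 - 2 * Real.exp (-c₁ * d) - 2 * (d : ℝ) ^ (-c)) ≤
            P {ω | ENNReal.ofReal
              (max 0 (1 - 1 / (k : ℝ) - C * (d * √(Real.log d) /
                  (AggregateLearning.sigmaMin A * √n))) ^ 2 * ‖θs‖ ^ 2
                + σ ^ 2 * (1 / ((k : ℝ) * n)) * ((A.trace - √(d * Real.log d)) /
                  (AggregateLearning.opNorm A + c₀ * √(d / n)) ^ 2)) ≤
              AggregateLearning.condRisk P θh θs x ω} := by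
  intro κ hκ
  set η : ℝ := min (1 / (256 * κ ^ 4)) (1 / (12 * κ ^ 2)) with hηdef
  have hη : 0 < η := by positivity
  have hη1 : 256 * η * κ ^ 4 ≤ 1 := by
    have h := (le_div_iff₀ (by positivity)).1 (min_le_left (1 / (256 * κ ^ 4)) (1 / (12 * κ ^ 2)))
    linarith
  have hη2 : 12 * η * κ ^ 2 ≤ 1 := by
    have h := (le_div_iff₀ (by positivity)).1 (min_le_right (1 / (256 * κ ^ 4)) (1 / (12 * κ ^ 2)))
    linarith
  -- On the good event `gramOp X / n` is within `t = 1920 κ² √(d/n)` of the covariance. Its inverse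
  -- is bounded by `2 / sigmaMin A` once `2 t ≤ sigmaMin A`, whence the factor `2` in `C`.
  refine ⟨2 * (1920 * κ ^ 2), η / 4, 1920 * κ ^ 2, 1, by positivity, by positivity,
    by positivity, one_pos, ?_⟩
  intro n d m k hdn hk Ω _ P _ A θs σ x ε B θh hA hx hε hxε hB hBk hBxy _ hmin
  -- In dimension at most one the claimed probability is not positive.
  rcases Nat.lt_or_ge d 2 with hd | hd
  · rw [ENNReal.ofReal_of_nonpos]
    · exact zero_le
    interval_cases d
    · have := Real.rpow_nonneg (le_refl (0 : ℝ)) (-(η / 4))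
      rw [Nat.cast_zero, mul_zero, Real.exp_zero]
      linarith
    · have := Real.exp_pos (-1 * ((1 : ℕ) : ℝ))
      rw [Nat.cast_one, Real.one_rpow]
      rw [Nat.cast_one] at this
      linarith
  have hn : 0 < n := by omega
  have hn' : (0 : ℝ) < n := by exact_mod_cast hn
  have hd0 : (0 : ℝ) < d := by
    have : 0 < d := by omega
    exact_mod_cast this
  obtain ⟨ω₀⟩ := P.nonempty_of_neZero
  have hkn : k ≤ n := by
    rw [← AggregateLearning.card_eq_mul_of_bag (hBk ω₀)]
    refine Nat.le_mul_of_pos_left k (Nat.pos_of_ne_zero fun hm => ?_)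
    subst hm
    exact (B ω₀ ⟨0, hn⟩).elim0
  -- The weights of the deterministic mixture of bag assignments.
  set p : (Fin n → Fin m) → ℝ := fun b => P.real (B ⁻¹' {b}) with hpdef
  have hp : ∀ b, 0 ≤ p b := fun b => measureReal_nonneg
  have hp1 : ∑ b, p b = 1 := by
    have := sum_measureReal_preimage_singleton (μ := P) (f := B) Finset.univ
      fun b _ => hB (measurableSet_singleton b)
    rw [hpdef, this]
    simp
  have hpb : ∀ b, p b ≠ 0 → ∀ l, (AggregateLearning.bag b l).card = k := fun b hb l => by
    obtain ⟨ω, hω⟩ := nonempty_of_measureReal_ne_zero hb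
    rw [← show B ω = b from hω]
    exact hBk ω l
  set t := 1920 * κ ^ 2 * √((d : ℝ) / n) with ht
  have ht0 : 0 < t := by positivity
  have hg : 0 < AggregateLearning.opNorm A + t := add_pos_of_nonneg_of_pos (norm_nonneg _) ht0
  have hσ := AggregateLearning.sigmaMin_pos (by omega) hA
  have hprob := hx.le_measure_goodDesigns hκ hA.isHermitian hd hdn hk hkn hp hp1 hpb hη hη1 hη2
  rw [← ht] at hprob
  rw [show -(1 : ℝ) * d = -d by ring]
  refine hprob.trans (measure_mono_ae ?_)
  have hSm := AggregateLearning.measurableSet_goodDesigns k p A t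
  set δ := 2 * (1920 * κ ^ 2) * (d * √(Real.log d) / (AggregateLearning.sigmaMin A * √n)) with hδ
  have htδ : 2 * t / AggregateLearning.sigmaMin A ≤ δ := by
    have h1 := AggregateLearning.sqrt_div_le_mul_sqrt_log (n := n) hd
    have h2 : δ = 2 * (1920 * κ ^ 2) * (d * √(Real.log d) / √n) /
        AggregateLearning.sigmaMin A := by
      rw [hδ]
      field_simp
    rw [h2, ht]
    gcongr ?_ / _
    calc 2 * (1920 * κ ^ 2 * √((d : ℝ) / n)) = 2 * (1920 * κ ^ 2) * √((d : ℝ) / n) := by ring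
      _ ≤ _ := by gcongr
  rcases le_or_gt (1 - 1 / (k : ℝ) - δ) 0 with hcase | hcase
  · -- The bias bound is void here, and `gramOp X` may be singular; a multiple of the identity
    -- suffices for the variance.
    have hae := AggregateLearning.ae_le_condRisk hn hx.measurable hε hxε hB hBk hBxy hmin
      (R := fun _ => (1 / (n * (AggregateLearning.opNorm A + t))) •
        ContinuousLinearMap.id ℝ (EuclideanSpace ℝ (Fin d))) measurable_const hSm
      (fun X hX v => by
        rw [smul_apply, ContinuousLinearMap.id_apply, norm_smul,
          Real.norm_of_nonneg (by positivity), one_div_mul_eq_div, div_le_iff₀ (by positivity),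
          mul_comm ‖v‖]
        exact AggregateLearning.norm_gramOp_apply_le hn hX v)
      (fun X hX => AggregateLearning.le_meanRisk_of_mem_goodDesigns hn hk hp hp1 hpb hg hX
        (β := 0) le_rfl (fun v => by
          rw [smul_apply, ContinuousLinearMap.id_apply, norm_smul,
            Real.norm_of_nonneg (by positivity)]) (norm_nonneg _))
    filter_upwards [hae] with ω hω hωS
    change ENNReal.ofReal (max 0 (1 - 1 / (k : ℝ) - δ) ^ 2 * ‖θs‖ ^ 2 + _) ≤ _
    rw [max_eq_left hcase]
    simpa using hω hωS
  · have ht2 : 2 * t ≤ AggregateLearning.sigmaMin A := by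
      have hk0 : 0 < 1 / (k : ℝ) := by
        have : (1 : ℝ) ≤ k := by exact_mod_cast hk
        positivity
      have h1 : 2 * t / AggregateLearning.sigmaMin A ≤ 1 := by linarith
      rwa [div_le_one hσ] at h1
    have hae := AggregateLearning.ae_le_condRisk hn hx.measurable hε hxε hB hBk hBxy hmin
      (R := fun X => Ring.inverse (AggregateLearning.gramOp X))
      AggregateLearning.measurable_inverse_gramOp hSm
      (fun X hX v => by
        have hunit := AggregateLearning.isUnit_of_mul_norm_le (by positivity)
          (AggregateLearning.mul_norm_le_gramOp hn hX ht2)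
        have : Ring.inverse (AggregateLearning.gramOp X) (AggregateLearning.gramOp X v) = v :=
          congrArg (fun T : EuclideanSpace ℝ (Fin d) →L[ℝ] EuclideanSpace ℝ (Fin d) => T v)
            (Ring.inverse_mul_cancel _ hunit)
        rw [this])
      (fun X hX => AggregateLearning.le_meanRisk_of_mem_goodDesigns hn hk hp hp1 hpb hg hX
        (β := (1 - 1 / (k : ℝ) - δ) * ‖θs‖) (by positivity)
        (AggregateLearning.mul_norm_le_inverse_gramOp hn hσ hg hX ht2)
        (le_trans (by gcongr)
          (AggregateLearning.le_norm_inverse_gramOp_bias hn hk hσ hX ht2 θs)))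
    filter_upwards [hae] with ω hω hωS
    change ENNReal.ofReal (max 0 (1 - 1 / (k : ℝ) - δ) ^ 2 * ‖θs‖ ^ 2 + _) ≤ _
    rw [max_eq_right hcase.le, ← mul_pow]
    exact hω hωS
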